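/- Let $G$ be a finite simple triconnected graph with more than $6$ vertices (triconnected: at least $4$ vertices, and connected after deleting any $2$ vertices). Let $\mathfrak R_3(G)$ be the set of all $3$-vertex sets $S\subset V(G)$ with $G-S$ disconnected ($3$-cutsets). A set $R\subset V(G)$ *splits* $X\subset V(G)$ if not all vertices of $X\setminus R$ lie in the same connected component of $G-R$. For $\mathfrak S\subset\mathfrak R_3(G)$ let $\mathcal P(\mathfrak S)$ be the set of *parts* of $\mathfrak S$, i.e. inclusion-maximal subsets of $V(G)$ split by no $S\in\mathfrak S$. For $A\in\mathcal P(\mathfrak S)$ let the *interior* $\mathrm{Int}(A)$ (resp. the *boundary* $\mathrm{Bound}(A)$) be the set of vertices of $A$ lying in no (resp. in at least one) member of $\mathfrak S$. $A$ is *empty* if $\mathrm{Int}(A)=\varnothing$, *small* if $|A|<3$, and *normal* if $|A|\ge 3$. Let $F=(p;q_1,\dots,q_m)$, $m\ge 4$, be a tuple of distinct vertices, the $q_i$ being cyclically ordered and indices taken modulo $m$; put $Q_{i,j}=\{q_i,q_j,p\}$, $V(F)=\{p,q_1,\dots,q_m\}$. $F$ is a *flower* with *center* $p$ and *petals* $q_i$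 if there is a set $\mathfrak S$ of $3$-cutsets of the form $Q_{i,j}$ with $i,j$ distinct and non-neighbouring in the cyclic order, such that $\mathcal P(\mathfrak S)$ consists of $m$ parts $G_{1,2},G_{2,3},\dots,G_{m,1}$ with $\mathrm{Bound}(G_{i,i+1})=Q_{i,i+1}$ (one says that $\mathfrak S$ *generates* $F$; the parts $G_{i,i+1}$ and their interiors below are those of such an $\mathfrak S$). A flower is *maximal* if no flower $F'$ with the same center has $V(F')\supsetneq V(F)$. It is *nondegenerate* if there is no set $M$ of three edges of $G$ such that $G-M$ is disconnected and every vertex of $V(F)$ is an end of an edge of $M$. It is *singular* if $p$ has degree $3$ in $G$. Let $F$ be a maximal nondegenerate flower. Define $u_{i,i+1}$ as follows. If either $F$ is singular and $\mathrm{Int}(G_{i,i+1})\ne\varnothing$ (then exactly one vertex of $G_{i,i+1}$ is adjacent to $p$), or $F$ is nonsingular, $G_{i,i+1}$ contains exactly one vertex adjacent to $p$ and $\mathrm{Int}(G_{i-1,i})=\mathrm{Int}(G_{i+1,i+2})=\varnothing$, let $u_{i,i+1}$ be the only vertex of $G_{i,i+1}$ adjacent to $p$. In all other cases put $u_{i,i+1}=p$.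 Let $O(F)=V(F)\cup\{u_{1,2},\dots,u_{m,1}\}$ and let the *complex* $\mathfrak C(F)$ be the set of all $3$-cutsets contained in $O(F)$ which split $O(F)$. Let $Q'_{i,i+1}=\{q_i,u_{i,i+1},q_{i+1}\}$. Let $G'_{i,i+1}=G_{i,i+1}\setminus\{p\}$ if either $u_{i,i+1}\neq p$, or $\mathrm{Int}(G_{i,i+1})=\varnothing$ and at least one of $u_{i-1,i},u_{i+1,i+2}$ differs from $p$; otherwise let $G'_{i,i+1}=G_{i,i+1}$. Let $T(p)$ consist of all vertices $u_{i,i+1}$ different from $p$ and all petals $q_j$ for which $\mathrm{Int}(G_{j-1,j})=\mathrm{Int}(G_{j,j+1})=\varnothing$, $u_{j-2,j-1}\ne p$ and $u_{j+1,j+2}\neq p$. **Lemma.** The set $\mathcal P(\mathfrak C(F))$ consists of all the sets $G'_{i,i+1}$ together with the small parts $\{p,x\}$, $x\in T(p)$. A part $G'_{i,i+1}$ is small if and only if $\mathrm{Int}(G_{i,i+1})=\varnothing$ and at least one of the vertices $u_{i-1,i}$ and $u_{i+1,i+2}$ differs from $p$. If the part $G'_{i,i+1}$ is normal, then its boundary,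 as a part of $\mathcal P(\mathfrak C(F))$, is $Q'_{i,i+1}$. -/

import Mathlib

namespace FlowerComplex

variable {V : Type*}

/-- `G` has at least four vertices and stays connected after deleting any two vertices. -/
def Triconnected (G : SimpleGraph V) : Prop :=
  4 ≤ Nat.card V ∧ ∀ S : Set V, S.ncard = 2 → (G.induce Sᶜ).Connected

/-- The vertices `x`, `y` lie outside `R` and in different connected components of `G - R`. -/
def SeparatesVertices (G : SimpleGraph V) (R : Set V) (x y : V) : Prop :=
  ∃ (hx : x ∈ Rᶜ) (hy : y ∈ Rᶜ), ¬ (G.induce Rᶜ).Reachable ⟨x, hx⟩ ⟨y, hy⟩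

/-- `R` splits `X`: not all vertices of `X \ R` lie in one connected component of `G - R`. -/
def Splits (G : SimpleGraph V) (R X : Set V) : Prop :=
  ∃ x ∈ X, ∃ y ∈ X, SeparatesVertices G R x y

/-- The set of all cutsets with exactly three vertices. -/
def cutsets3 (G : SimpleGraph V) : Set (Set V) :=
  {S | S.ncard = 3 ∧ ¬ (G.induce Sᶜ).Preconnected}

/-- The parts of the decomposition of `G` by a family `𝔖` of cutsets: the inclusion-maximal sets
of vertices which are split by no member of `𝔖`. -/
def parts (G : SimpleGraph V) (𝔖 : Set (Set V)) : Set (Set V) :=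
  {A | Maximal (fun B : Set V => ∀ S ∈ 𝔖, ¬ Splits G S B) A}

/-- The vertices of `A` belonging to no member of `𝔖`. -/
def interior (𝔖 : Set (Set V)) (A : Set V) : Set V :=
  {v | v ∈ A ∧ ∀ S ∈ 𝔖, v ∉ S}

/-- The vertices of `A` belonging to some member of `𝔖`. -/
def boundary (𝔖 : Set (Set V)) (A : Set V) : Set V :=
  {v | v ∈ A ∧ ∃ S ∈ 𝔖, v ∈ S}

def IsSmall (A : Set V) : Prop := A.ncard < 3

def IsNormal (A : Set V) : Prop := 3 ≤ A.ncard

/-- A tuple `(p; q_1, …, q_m)` of distinct vertices, `m ≥ 4`, with cyclically indexed petals. -/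
structure CyclicTuple (V : Type*) where
  m : ℕ
  four_le : 4 ≤ m
  center : V
  petal : ZMod m → V
  petal_injective : Function.Injective petal
  petal_ne_center : ∀ i, petal i ≠ center

namespace CyclicTuple

/-- `Q_{i,j} = {q_i, q_j, p}`. -/
def Q (F : CyclicTuple V) (i j : ZMod F.m) : Set V := {F.petal i, F.petal j, F.center}

/-- All `Q_{i,j}` with `i`, `j` different and not neighbouring in the cyclic order. -/
def innerSets (F : CyclicTuple V) : Set (Set V) :=
  {S | ∃ i j : ZMod F.m, i ≠ j ∧ j ≠ i + 1 ∧ i ≠ j + 1 ∧ S = F.Q i j}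

/-- The vertex set `V(F)`. -/
def verts (F : CyclicTuple V) : Set V := insert F.center (Set.range F.petal)

/-- A family `𝔖` of 3-cutsets which generates the flower `F`, with its parts `G_{i,i+1}`
(written `part i`). The parts are pairwise different as their boundaries are. -/
structure Generation (G : SimpleGraph V) (F : CyclicTuple V) where
  𝔖 : Set (Set V)
  subset_cutsets3 : 𝔖 ⊆ cutsets3 G
  subset_innerSets : 𝔖 ⊆ F.innerSets
  part : ZMod F.m → Set V
  parts_eq : parts G 𝔖 = Set.range part
  boundary_part : ∀ i, boundary 𝔖 (part i) = F.Q i (i + 1)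

def IsFlower (G : SimpleGraph V) (F : CyclicTuple V) : Prop := Nonempty (Generation G F)

/-- `F` is a flower, and no other flower contains it, i.e. has the same center and a larger vertex
set (a flower is determined by its center and its set of petals up to the choice of the first petal
and of the direction of the cyclic order). -/
def IsMaximalFlower (G : SimpleGraph V) (F : CyclicTuple V) : Prop :=
  F.IsFlower G ∧ ∀ F' : CyclicTuple V, F'.IsFlower G → F'.center = F.center →
    F.verts ⊆ F'.verts → F'.verts = F.verts

end CyclicTuple

/-- The cuts consisting of exactly three edges. -/
def cuts3 (G : SimpleGraph V) : Set (Set (Sym2 V)) :=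
  {M | M ⊆ G.edgeSet ∧ M.ncard = 3 ∧ ¬ (G.deleteEdges M).Preconnected}

/-- The set of all ends of the edges of `M`. -/
def edgeVerts (M : Set (Sym2 V)) : Set V := {v | ∃ e ∈ M, v ∈ e}

namespace CyclicTuple

/-- No cut consisting of three edges contains `F`. -/
def IsNondegenerate (G : SimpleGraph V) (F : CyclicTuple V) : Prop :=
  ∀ M ∈ cuts3 G, ¬ F.verts ⊆ edgeVerts M

/-- The center has degree three. -/
def IsSingular (G : SimpleGraph V) (F : CyclicTuple V) : Prop :=
  (G.neighborSet F.center).ncard = 3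

namespace Generation

variable {G : SimpleGraph V} {F : CyclicTuple V}

/-- `I(G_{i,i+1})`. -/
def inner (D : Generation G F) (i : ZMod F.m) : Set V := interior D.𝔖 (D.part i)

open Classical in
/-- `u_{i,i+1}`: the unique neighbour of the center in `G_{i,i+1}` if either `F` is singular and
`G_{i,i+1}` is nonempty, or `F` is nonsingular and both neighbouring parts are empty; the center in
all other cases. -/
noncomputable def u (D : Generation G F) (i : ZMod F.m) : V :=
  if h : (∃! x, x ∈ D.part i ∧ G.Adj F.center x) ∧
      ((F.IsSingular G ∧ (D.inner i).Nonempty) ∨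
        (¬ F.IsSingular G ∧ D.inner (i - 1) = ∅ ∧ D.inner (i + 1) = ∅))
  then h.1.choose else F.center

/-- The neighbourhood `O(F)`. -/
def nbhd (D : Generation G F) : Set V := F.verts ∪ Set.range D.u

/-- `Q'_{i,i+1}`. -/
def Q' (D : Generation G F) (i : ZMod F.m) : Set V := {F.petal i, D.u i, F.petal (i + 1)}

open Classical in
/-- `G'_{i,i+1}`. -/
noncomputable def part' (D : Generation G F) (i : ZMod F.m) : Set V :=
  if D.u i ≠ F.center ∨
      (D.inner i = ∅ ∧ (D.u (i - 1) ≠ F.center ∨ D.u (i + 1) ≠ F.center))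
  then D.part i \ {F.center} else D.part i

/-- The complex `C(F)`: all 3-cutsets contained in `O(F)` which split `O(F)`. -/
def complex (D : Generation G F) : Set (Set V) :=
  {T | T ∈ cutsets3 G ∧ T ⊆ D.nbhd ∧ Splits G T D.nbhd}

/-- The neighbourhood `T(p)` of the center: all `u_{i,i+1}` different from the center, and all
petals `q_j` such that `G_{j-1,j}`, `G_{j,j+1}` are empty while `u_{j-2,j-1}`, `u_{j+1,j+2}` differ
from the center. -/
def centerNbhd (D : Generation G F) : Set V :=
  {x | ∃ i, x = D.u i ∧ D.u i ≠ F.center} ∪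
  {x | ∃ j, x = F.petal j ∧ D.inner (j - 1) = ∅ ∧ D.inner j = ∅ ∧
    D.u (j - 2) ≠ F.center ∧ D.u (j + 1) ≠ F.center}

end Generation

end CyclicTuple

end FlowerComplex

/-! The parts of a flower form a cyclic cover of the graph. Every edge lies in one part, and
distinct parts meet only in the center `p` and, when cyclically adjacent, in their common petal.
Conversely, every such cover comes from a flower (`isFlower`). Triconnectivity then fixes the local
structure: each component of an interior reaches all three boundary vertices, the petals of an empty
part are adjacent, and a petal between two empty parts is adjacent to `p`.

The complex contains all the sets Q_{j,j+2}, so a set it does not split lies in a single part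
G_{i,i+1} (`exists_subset`). If u_{i,i+1} ≠ p, then u_{i,i+1} is the only neighbour of `p` in that
part, and some member of the complex separates `p` from the rest of the part (`exists_separator`).
The separator is the neighbourhood of `p` in the singular case and {q_{i-1}, u_{i,i+1}, q_{i+2}}
otherwise. Hence an unsplit set containing `p` and meeting such a part has there at most `p` and
u_{i,i+1}. This yields the small parts {p, x} and the loss of `p` from some G'
(`exists_superset_of_not_splits`).

It remains to see that no G' is split (`not_splits_part'`). Members of the complex meet an interior
at most in u_{i,i+1}, and since they must split O(F) they cannot be Q'_{i,i+1}. If u_{i,i+1}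
separated q_i from q_{i+1} within the part without `p`, it could be inserted as a new petal, against
maximality (`joined_of_isMaximalFlower`). Nondegeneracy enters only in the singular case: two
neighbours of `p` in one nonempty part would produce a forbidden cut of three edges
(`eq_of_adj_center`). -/

namespace FlowerComplex

/-! ### Connectedness off a set, splitting, and parts of a family of cutsets. -/

variable {V : Type*} {G : SimpleGraph V}

/-- The vertices `x`, `y` lie outside `R` and in the same connected component of `G - R`. -/
def Joined (G : SimpleGraph V) (R : Set V) (x y : V) : Prop :=
  ∃ (hx : x ∈ Rᶜ) (hy : y ∈ Rᶜ), (G.induce Rᶜ).Reachable ⟨x, hx⟩ ⟨y, hy⟩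

namespace Joined

variable {R : Set V} {x y z : V}

theorem refl (hx : x ∉ R) : Joined G R x x := ⟨hx, hx, SimpleGraph.Reachable.refl _⟩

theorem symm (h : Joined G R x y) : Joined G R y x := by
  obtain ⟨hx, hy, h⟩ := h
  exact ⟨hy, hx, h.symm⟩

theorem trans (h : Joined G R x y) (h' : Joined G R y z) : Joined G R x z := by
  obtain ⟨hx, hy, h⟩ := h
  obtain ⟨_, hz, h'⟩ := h'
  exact ⟨hx, hz, h.trans h'⟩

theorem of_adj (h : G.Adj x y) (hx : x ∉ R) (hy : y ∉ R) : Joined G R x y :=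
  ⟨hx, hy, SimpleGraph.Adj.reachable (by simpa using h)⟩

theorem mem_of_closed {W : Set V} (h : Joined G R x y) (hx : x ∈ W)
    (hW : ∀ w ∈ W, ∀ v, G.Adj w v → v ∈ W ∨ v ∈ R) : y ∈ W := by
  obtain ⟨hx', hy', ⟨p⟩⟩ := h
  have key : ∀ (a b : (Rᶜ : Set V)), (G.induce Rᶜ).Walk a b → (a : V) ∈ W → (b : V) ∈ W := by
    intro a b p
    induction p with
    | nil => exact id
    | @cons u v w hadj _ ih =>
      intro hu
      have hadj' : G.Adj u v := by simpa using hadj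
      exact ih ((hW u hu v hadj').resolve_right v.2)
  exact key _ _ p hx

end Joined

theorem separates_iff {R : Set V} {x y : V} :
    SeparatesVertices G R x y ↔ x ∉ R ∧ y ∉ R ∧ ¬ Joined G R x y := by
  constructor
  · rintro ⟨hx, hy, h⟩
    exact ⟨hx, hy, fun ⟨_, _, h'⟩ => h h'⟩
  · rintro ⟨hx, hy, h⟩
    exact ⟨hx, hy, fun h' => h ⟨hx, hy, h'⟩⟩

/-- Every explicit separation below is exhibited by such a set `W`, whose outer neighbours all lie
in `R`. -/
theorem separates_of_closed {R W : Set V} {x y : V} (hx : x ∈ W) (hy : y ∉ W) (hxR : x ∉ R)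
    (hyR : y ∉ R) (hW : ∀ w ∈ W, ∀ v, G.Adj w v → v ∈ W ∨ v ∈ R) : SeparatesVertices G R x y :=
  separates_iff.2 ⟨hxR, hyR, fun h => hy (h.mem_of_closed hx hW)⟩

theorem not_splits_iff {R X : Set V} :
    ¬ Splits G R X ↔ ∀ x ∈ X, ∀ y ∈ X, x ∉ R → y ∉ R → Joined G R x y := by
  simp only [Splits, separates_iff]
  push Not
  rfl

theorem not_splits_of_joined {R X : Set V} (z : V) (h : ∀ x ∈ X, x ∉ R → Joined G R x z) :
    ¬ Splits G R X :=
  not_splits_iff.2 fun x hx y hy hxR hyR => (h x hx hxR).trans (h y hy hyR).symm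

theorem Splits.mono {R X Y : Set V} (h : Splits G R X) (hXY : X ⊆ Y) : Splits G R Y := by
  obtain ⟨x, hx, y, hy, h⟩ := h
  exact ⟨x, hXY hx, y, hXY hy, h⟩

theorem not_splits_pair {R : Set V} {x y : V} (h : G.Adj x y) : ¬ Splits G R {x, y} := by
  rw [not_splits_iff]
  rintro a (rfl | rfl) b (rfl | rfl) ha hb
  · exact .refl ha
  · exact .of_adj h ha hb
  · exact .of_adj h.symm ha hb
  · exact .refl ha

theorem mem_cutsets3_of_separates {R : Set V} {x y : V} (hR : R.ncard = 3)
    (h : SeparatesVertices G R x y) : R ∈ cutsets3 G := by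
  obtain ⟨hx, hy, h⟩ := h
  exact ⟨hR, fun hc => h (hc _ _)⟩

theorem ncard_triple {a b c : V} (hab : a ≠ b) (hac : a ≠ c) (hbc : b ≠ c) :
    ({a, b, c} : Set V).ncard = 3 :=
  Set.ncard_eq_three.2 ⟨a, b, c, hab, hac, hbc, rfl⟩

theorem ncard_pair_le (a b : V) : ({a, b} : Set V).ncard ≤ 2 :=
  (Set.ncard_insert_le a {b}).trans (by rw [Set.ncard_singleton])

theorem exists_part_superset [Finite V] {𝔖 : Set (Set V)} {X : Set V}
    (h : ∀ S ∈ 𝔖, ¬ Splits G S X) : ∃ A ∈ parts G 𝔖, X ⊆ A := by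
  obtain ⟨A, hXA, hA⟩ := (Set.toFinite {B : Set V | ∀ S ∈ 𝔖, ¬ Splits G S B}).exists_le_maximal h
  exact ⟨A, hA, hXA⟩

theorem not_splits_of_mem_parts {𝔖 : Set (Set V)} {A S : Set V} (hA : A ∈ parts G 𝔖)
    (hS : S ∈ 𝔖) : ¬ Splits G S A := by
  have hA' : Maximal (fun B : Set V => ∀ S ∈ 𝔖, ¬ Splits G S B) A := hA
  exact hA'.prop S hS

theorem eq_of_mem_parts {𝔖 : Set (Set V)} {A B : Set V} (hA : A ∈ parts G 𝔖)
    (hB : ∀ S ∈ 𝔖, ¬ Splits G S B) (hAB : A ⊆ B) : A = B := by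
  have hA' : Maximal (fun B : Set V => ∀ S ∈ 𝔖, ¬ Splits G S B) A := hA
  exact hA'.eq_of_subset hB hAB

/-- A vertex outside all cutsets acts as a hub: after deleting any `S`, what is left of `A ∪ B` is
joined to `v`. So the union is not split, and maximality makes both parts equal to it. -/
theorem parts_eq_of_mem {𝔖 : Set (Set V)} {A B : Set V} (hA : A ∈ parts G 𝔖) (hB : B ∈ parts G 𝔖)
    {v : V} (hv : ∀ S ∈ 𝔖, v ∉ S) (hvA : v ∈ A) (hvB : v ∈ B) : A = B := by
  have hAB : ∀ S ∈ 𝔖, ¬ Splits G S (A ∪ B) := by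
    intro S hS
    refine not_splits_of_joined v ?_
    rintro x (hx | hx) hxS
    · exact not_splits_iff.1 (not_splits_of_mem_parts hA hS) x hx v hvA hxS (hv S hS)
    · exact not_splits_iff.1 (not_splits_of_mem_parts hB hS) x hx v hvB hxS (hv S hS)
  exact (eq_of_mem_parts hA hAB Set.subset_union_left).trans
    (eq_of_mem_parts hB hAB Set.subset_union_right).symm

/-- A family of sets, none split by `𝔖`, pairwise incomparable, such that every set not split by
`𝔖` lies in one of them, is the family of parts. -/
theorem parts_eq_of_antichain {𝔖 𝔓 : Set (Set V)} (h₁ : ∀ A ∈ 𝔓, ∀ S ∈ 𝔖, ¬ Splits G S A)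
    (h₂ : ∀ A ∈ 𝔓, ∀ B ∈ 𝔓, A ⊆ B → A = B)
    (h₃ : ∀ A : Set V, (∀ S ∈ 𝔖, ¬ Splits G S A) → ∃ B ∈ 𝔓, A ⊆ B) : parts G 𝔖 = 𝔓 := by
  ext A
  constructor
  · intro hA
    obtain ⟨B, hB, hAB⟩ := h₃ A fun S hS => not_splits_of_mem_parts hA hS
    rwa [eq_of_mem_parts hA (h₁ B hB) hAB]
  · intro hA
    refine ⟨h₁ A hA, fun B hB hAB => ?_⟩
    obtain ⟨C, hC, hBC⟩ := h₃ B hB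
    have hAB' : A ⊆ B := hAB
    have := h₂ A hA C hC (hAB'.trans hBC)
    exact this ▸ hBC

/-! ### Consequences of triconnectivity. -/

namespace Triconnected

/-- Otherwise {a, b} would separate `w` from `u`. This is the only form in which connectedness after
deleting two vertices is used. -/
theorem exists_adj (hG : Triconnected G) {W : Set V} {a b w u : V} (hab : a ≠ b) (hw : w ∈ W)
    (haW : a ∉ W) (hbW : b ∉ W) (hu : u ∉ W) (hua : u ≠ a) (hub : u ≠ b) :
    ∃ x ∈ W, ∃ y, y ∉ W ∧ y ≠ a ∧ y ≠ b ∧ G.Adj x y := by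
  by_contra! h
  have hwR : w ∉ ({a, b} : Set V) := by
    rintro (rfl | rfl) <;> contradiction
  have huR : u ∉ ({a, b} : Set V) := by
    rintro (rfl | rfl) <;> contradiction
  have hJ : Joined G {a, b} w u :=
    ⟨hwR, huR, (hG.2 {a, b} (Set.ncard_pair hab)).preconnected _ _⟩
  refine hu (hJ.mem_of_closed hw fun x hx y hxy => ?_)
  by_contra! hy
  simp only [Set.mem_insert_iff, Set.mem_singleton_iff, not_or] at hy
  exact h x hx y hy.1 hy.2.1 hy.2.2 hxy

/-- If all neighbours of `I` lie in `I ∪ {a, b, c}`, then every component of `G[I]` contains a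
neighbour of `a`. -/
theorem exists_joined_adj (hG : Triconnected G) {I R : Set V} {a b c x : V} (hab : a ≠ b)
    (hac : a ≠ c) (hbc : b ≠ c) (haI : a ∉ I) (hbI : b ∉ I) (hcI : c ∉ I)
    (hI : ∀ w ∈ I, ∀ v, G.Adj w v → v ∈ I ∨ v = a ∨ v = b ∨ v = c)
    (hR : ∀ w ∈ I, w ∉ R) (hx : x ∈ I) : ∃ w ∈ I, Joined G R x w ∧ G.Adj w a := by
  -- Applied to the component of `x` in `I` with `b` and `c` deleted: the only exit left is `a`.
  obtain ⟨w, ⟨hwI, hxw⟩, y, hy, hyb, hyc, hwy⟩ :=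
    hG.exists_adj (W := {w | w ∈ I ∧ Joined G R x w}) (w := x) (u := a) hbc
      ⟨hx, .refl (hR x hx)⟩ (fun h => hbI h.1) (fun h => hcI h.1) (fun h => haI h.1) hab hac
  have : y = a := by
    rcases hI w hwI y hwy with h | h | h | h
    · exact (hy ⟨h, hxw.trans (.of_adj hwy (hR w hwI) (hR y h))⟩).elim
    · exact h
    · exact (hyb h).elim
    · exact (hyc h).elim
  exact ⟨w, hwI, hxw, this ▸ hwy⟩

theorem joined_of_mem (hG : Triconnected G) {I R : Set V} {a b c x : V} (hab : a ≠ b)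
    (hac : a ≠ c) (hbc : b ≠ c) (haI : a ∉ I) (hbI : b ∉ I) (hcI : c ∉ I)
    (hI : ∀ w ∈ I, ∀ v, G.Adj w v → v ∈ I ∨ v = a ∨ v = b ∨ v = c)
    (hR : ∀ w ∈ I, w ∉ R) (hx : x ∈ I) (haR : a ∉ R) : Joined G R x a := by
  obtain ⟨w, hw, hxw, hwa⟩ := hG.exists_joined_adj hab hac hbc haI hbI hcI hI hR hx
  exact hxw.trans (.of_adj hwa (hR w hw) haR)

end Triconnected

/-! ### Cyclic indices, and the cover of the graph by the parts of a flower. -/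

namespace CyclicTuple

theorem natCast_ne_zero (F : CyclicTuple V) {n : ℕ} (hn : n ≠ 0) (hm : n < F.m) :
    (n : ZMod F.m) ≠ 0 := by
  rw [Ne, ZMod.natCast_eq_zero_iff]
  exact fun h => absurd (Nat.le_of_dvd (Nat.pos_of_ne_zero hn) h) (by omega)

theorem one_ne (F : CyclicTuple V) : (1 : ZMod F.m) ≠ 0 := by
  have := F.natCast_ne_zero (n := 1) (by simp) (by linarith [F.four_le])
  simpa using this

theorem two_ne (F : CyclicTuple V) : (2 : ZMod F.m) ≠ 0 := by
  have := F.natCast_ne_zero (n := 2) (by simp) (by linarith [F.four_le])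
  simpa using this

theorem three_ne (F : CyclicTuple V) : (3 : ZMod F.m) ≠ 0 := by
  have := F.natCast_ne_zero (n := 3) (by simp) (by linarith [F.four_le])
  simpa using this

theorem petal_ne (F : CyclicTuple V) {i j : ZMod F.m} (h : i ≠ j) : F.petal i ≠ F.petal j :=
  fun h' => h (F.petal_injective h')

theorem center_mem_verts (F : CyclicTuple V) : F.center ∈ F.verts := Set.mem_insert _ _

theorem petal_mem_verts (F : CyclicTuple V) (i : ZMod F.m) : F.petal i ∈ F.verts :=
  Set.mem_insert_of_mem _ ⟨i, rfl⟩

theorem mem_Q_iff (F : CyclicTuple V) {i j : ZMod F.m} {v : V} :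
    v ∈ F.Q i j ↔ v = F.petal i ∨ v = F.petal j ∨ v = F.center := Iff.rfl

theorem petal_mem_Q_iff (F : CyclicTuple V) {i j k : ZMod F.m} :
    F.petal k ∈ F.Q i j ↔ k = i ∨ k = j := by
  simp [mem_Q_iff, F.petal_injective.eq_iff, F.petal_ne_center]

theorem Q_subset_verts (F : CyclicTuple V) (i j : ZMod F.m) : F.Q i j ⊆ F.verts := by
  rintro v (rfl | rfl | rfl)
  exacts [F.petal_mem_verts i, F.petal_mem_verts j, F.center_mem_verts]

theorem ncard_Q (F : CyclicTuple V) {i j : ZMod F.m} (h : i ≠ j) : (F.Q i j).ncard = 3 :=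
  ncard_triple (F.petal_ne h) (F.petal_ne_center i) (F.petal_ne_center j)

theorem subset_verts_of_mem_innerSets (F : CyclicTuple V) {S : Set V} (h : S ∈ F.innerSets) :
    S ⊆ F.verts := by
  obtain ⟨i, j, _, _, _, rfl⟩ := h
  exact F.Q_subset_verts i j

/-- The sets `P i` cover the graph `G`, and meet each other cyclically in the vertices of `F`. -/
structure IsCyclicCover (G : SimpleGraph V) (F : CyclicTuple V) (P : ZMod F.m → Set V) : Prop where
  cover : ∀ v, ∃ i, v ∈ P i
  adj : ∀ v w, G.Adj v w → ∃ i, v ∈ P i ∧ w ∈ P i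
  inter_verts : ∀ i, P i ∩ F.verts = F.Q i (i + 1)
  eq_of_mem : ∀ v, v ∉ F.verts → ∀ i j, v ∈ P i → v ∈ P j → i = j

namespace Generation

variable {F : CyclicTuple V}

theorem mem_verts_iff (D : Generation G F) {v : V} : v ∈ F.verts ↔ ∃ S ∈ D.𝔖, v ∈ S := by
  constructor
  · intro hv
    have : ∃ i, v ∈ F.Q i (i + 1) := by
      rcases hv with rfl | ⟨i, rfl⟩
      · exact ⟨0, Or.inr (Or.inr rfl)⟩
      · exact ⟨i, Or.inl rfl⟩
    obtain ⟨i, hi⟩ := this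
    rw [← D.boundary_part i] at hi
    exact hi.2
  · rintro ⟨S, hS, hv⟩
    exact F.subset_verts_of_mem_innerSets (D.subset_innerSets hS) hv

theorem part_mem (D : Generation G F) (i : ZMod F.m) : D.part i ∈ parts G D.𝔖 :=
  D.parts_eq ▸ Set.mem_range_self i

theorem exists_subset_part [Finite V] (D : Generation G F) {X : Set V}
    (h : ∀ S ∈ D.𝔖, ¬ Splits G S X) : ∃ i, X ⊆ D.part i := by
  obtain ⟨A, hA, hXA⟩ := exists_part_superset h
  rw [D.parts_eq] at hA
  obtain ⟨i, rfl⟩ := hA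
  exact ⟨i, hXA⟩

theorem part_inter_verts (D : Generation G F) (i : ZMod F.m) :
    D.part i ∩ F.verts = F.Q i (i + 1) := by
  rw [← D.boundary_part i]
  ext v
  simp only [Set.mem_inter_iff, D.mem_verts_iff, boundary, Set.mem_ofPred_eq]

theorem inner_eq (D : Generation G F) (i : ZMod F.m) : D.inner i = D.part i \ F.verts := by
  ext v
  simp only [inner, interior, Set.mem_sdiff, D.mem_verts_iff, Set.mem_ofPred_eq, not_exists, not_and]

/-- Single vertices and edges are never split, so each lies in a part. A vertex off the flower lies
in no cutset of the family, so its part is unique as a set; equality of boundaries then gives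
equality of indices, as 2 ≠ 0 modulo m. -/
theorem isCyclicCover [Finite V] (D : Generation G F) : IsCyclicCover G F D.part where
  cover v := by
    obtain ⟨i, hi⟩ := D.exists_subset_part (X := {v}) fun S _ =>
      not_splits_iff.2 (by rintro x rfl y rfl hx _; exact .refl hx)
    exact ⟨i, hi rfl⟩
  adj v w h := by
    obtain ⟨i, hi⟩ := D.exists_subset_part (X := {v, w}) fun S _ => not_splits_pair h
    exact ⟨i, hi (by simp), hi (by simp)⟩
  inter_verts := D.part_inter_verts
  eq_of_mem v hv i j hi hj := by
    have hij : D.part i = D.part j := parts_eq_of_mem (D.part_mem i) (D.part_mem j)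
      (fun S hS hvS => hv (D.mem_verts_iff.2 ⟨S, hS, hvS⟩)) hi hj
    have hQ : F.Q i (i + 1) = F.Q j (j + 1) := by
      rw [← D.part_inter_verts, ← D.part_inter_verts, hij]
    have h₁ : i = j ∨ i = j + 1 := F.petal_mem_Q_iff.1 (hQ ▸ Or.inl rfl)
    have h₂ : j = i ∨ j = i + 1 := F.petal_mem_Q_iff.1 (hQ.symm ▸ Or.inl rfl)
    have := F.two_ne
    grind

end Generation

/-! ### Adjacency and connectedness in a cyclic cover, and the flower it defines. -/

namespace IsCyclicCover

variable {F : CyclicTuple V} {P : ZMod F.m → Set V}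

theorem petal_mem_iff (hP : IsCyclicCover G F P) {i k : ZMod F.m} :
    F.petal k ∈ P i ↔ k = i ∨ k = i + 1 := by
  rw [← F.petal_mem_Q_iff, ← hP.inter_verts]
  exact ⟨fun h => ⟨h, F.petal_mem_verts k⟩, fun h => h.1⟩

theorem left_mem (hP : IsCyclicCover G F P) (i : ZMod F.m) : F.petal i ∈ P i :=
  hP.petal_mem_iff.2 (Or.inl rfl)

theorem right_mem (hP : IsCyclicCover G F P) (i : ZMod F.m) : F.petal (i + 1) ∈ P i :=
  hP.petal_mem_iff.2 (Or.inr rfl)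

theorem center_mem (hP : IsCyclicCover G F P) (i : ZMod F.m) : F.center ∈ P i := by
  have : F.center ∈ F.Q i (i + 1) := Or.inr (Or.inr rfl)
  rw [← hP.inter_verts] at this
  exact this.1

theorem mem_cases (hP : IsCyclicCover G F P) {i : ZMod F.m} {v : V} (h : v ∈ P i) :
    v ∈ P i \ F.verts ∨ v = F.petal i ∨ v = F.petal (i + 1) ∨ v = F.center := by
  by_cases hv : v ∈ F.verts
  · right
    have : v ∈ P i ∩ F.verts := ⟨h, hv⟩
    rwa [hP.inter_verts] at this
  · exact Or.inl ⟨h, hv⟩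

theorem cases (hP : IsCyclicCover G F P) (v : V) :
    v = F.center ∨ (∃ i, v = F.petal i) ∨ ∃ i, v ∈ P i \ F.verts := by
  by_cases hv : v ∈ F.verts
  · rcases hv with rfl | ⟨i, rfl⟩
    · exact Or.inl rfl
    · exact Or.inr (Or.inl ⟨i, rfl⟩)
  · obtain ⟨i, hi⟩ := hP.cover v
    exact Or.inr (Or.inr ⟨i, hi, hv⟩)

theorem mem_of_adj (hP : IsCyclicCover G F P) {i : ZMod F.m} {w v : V} (hw : w ∈ P i \ F.verts)
    (h : G.Adj w v) : v ∈ P i := by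
  obtain ⟨j, hwj, hvj⟩ := hP.adj w v h
  rwa [hP.eq_of_mem w hw.2 i j hw.1 hwj]

theorem inner_adj (hP : IsCyclicCover G F P) {i : ZMod F.m} (w : V) (hw : w ∈ P i \ F.verts)
    (v : V) (h : G.Adj w v) :
    v ∈ P i \ F.verts ∨ v = F.petal i ∨ v = F.petal (i + 1) ∨ v = F.center :=
  hP.mem_cases (hP.mem_of_adj hw h)

theorem mem_of_petal_adj (hP : IsCyclicCover G F P) {i : ZMod F.m} {v : V}
    (h : G.Adj (F.petal i) v) : v ∈ P (i - 1) ∨ v ∈ P i := by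
  obtain ⟨j, hj, hv⟩ := hP.adj _ v h
  rcases hP.petal_mem_iff.1 hj with rfl | rfl
  · exact Or.inr hv
  · left; simpa using hv

theorem left_ne_right (F : CyclicTuple V) (i : ZMod F.m) : F.petal i ≠ F.petal (i + 1) :=
  F.petal_ne (by simpa using F.one_ne)

/-- Every component of the interior of `P i` contains a neighbour of the center. -/
theorem exists_joined_adj_center (hP : IsCyclicCover G F P) (hG : Triconnected G) {R : Set V}
    {i : ZMod F.m} {x : V} (hR : ∀ w ∈ P i \ F.verts, w ∉ R) (hx : x ∈ P i \ F.verts) :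
    ∃ w ∈ P i \ F.verts, Joined G R x w ∧ G.Adj w F.center :=
  hG.exists_joined_adj (I := P i \ F.verts) (F.petal_ne_center i).symm
    (F.petal_ne_center (i + 1)).symm (left_ne_right F i) (fun h => h.2 F.center_mem_verts)
    (fun h => h.2 (F.petal_mem_verts _)) (fun h => h.2 (F.petal_mem_verts _))
    (fun w hw v h => by have := hP.inner_adj w hw v h; tauto) hR hx

theorem exists_adj_center (hP : IsCyclicCover G F P) (hG : Triconnected G)
    {i : ZMod F.m} (h : (P i \ F.verts).Nonempty) : ∃ w ∈ P i \ F.verts, G.Adj F.center w := by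
  obtain ⟨x, hx⟩ := h
  obtain ⟨w, hw, -, h⟩ := hP.exists_joined_adj_center hG (R := ∅) (by simp) hx
  exact ⟨w, hw, h.symm⟩

theorem joined_center (hP : IsCyclicCover G F P) (hG : Triconnected G) {R : Set V}
    {i : ZMod F.m} {x : V} (hR : ∀ w ∈ P i \ F.verts, w ∉ R) (hx : x ∈ P i \ F.verts)
    (hc : F.center ∉ R) : Joined G R x F.center := by
  obtain ⟨w, hw, hxw, h⟩ := hP.exists_joined_adj_center hG hR hx
  exact hxw.trans (.of_adj h (hR w hw) hc)

theorem joined_left (hP : IsCyclicCover G F P) (hG : Triconnected G) {R : Set V}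
    {i : ZMod F.m} {x : V} (hR : ∀ w ∈ P i \ F.verts, w ∉ R) (hx : x ∈ P i \ F.verts)
    (hc : F.petal i ∉ R) : Joined G R x (F.petal i) :=
  hG.joined_of_mem (I := P i \ F.verts) (left_ne_right F i) (F.petal_ne_center i)
    (F.petal_ne_center (i + 1)) (fun h => h.2 (F.petal_mem_verts _))
    (fun h => h.2 (F.petal_mem_verts _)) (fun h => h.2 F.center_mem_verts)
    hP.inner_adj hR hx hc

theorem joined_right (hP : IsCyclicCover G F P) (hG : Triconnected G) {R : Set V}
    {i : ZMod F.m} {x : V} (hR : ∀ w ∈ P i \ F.verts, w ∉ R) (hx : x ∈ P i \ F.verts)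
    (hc : F.petal (i + 1) ∉ R) : Joined G R x (F.petal (i + 1)) :=
  hG.joined_of_mem (I := P i \ F.verts) (left_ne_right F i).symm (F.petal_ne_center _)
    (F.petal_ne_center i) (fun h => h.2 (F.petal_mem_verts _))
    (fun h => h.2 (F.petal_mem_verts _)) (fun h => h.2 F.center_mem_verts)
    (fun w hw v h => by have := hP.inner_adj w hw v h; tauto) hR hx hc

theorem mem_of_eq_empty (hP : IsCyclicCover G F P) {i : ZMod F.m} (hi : P i \ F.verts = ∅) {v : V}
    (h : v ∈ P i) : v = F.petal i ∨ v = F.petal (i + 1) ∨ v = F.center :=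
  (hP.mem_cases h).resolve_left (by simp [hi])

/-- Deleting `p` and q_{i+2} cannot isolate q_{i+1} together with the interior of the next part. An
escaping edge must start at q_{i+1} and go into the empty part, where only q_i is available. -/
theorem petal_adj_petal (hP : IsCyclicCover G F P) (hG : Triconnected G) {i : ZMod F.m}
    (hi : P i \ F.verts = ∅) : G.Adj (F.petal i) (F.petal (i + 1)) := by
  have h₁ := F.one_ne
  have h₂ := F.two_ne
  have h₃ := F.three_ne
  obtain ⟨x, hx, y, hy, hya, hyb, hxy⟩ := hG.exists_adj
    (W := insert (F.petal (i + 1)) (P (i + 1) \ F.verts)) (a := F.center) (b := F.petal (i + 2))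
    (w := F.petal (i + 1)) (u := F.petal i) (F.petal_ne_center _).symm (Set.mem_insert _ _)
    (by
      rintro (h | h)
      · exact F.petal_ne_center _ h.symm
      · exact h.2 F.center_mem_verts)
    (by
      rintro (h | h)
      · exact h₁ (by linear_combination F.petal_injective h)
      · exact h.2 (F.petal_mem_verts _))
    (by
      rintro (h | h)
      · exact h₁ (by linear_combination -F.petal_injective h)
      · exact h.2 (F.petal_mem_verts _))
    (F.petal_ne_center _) (F.petal_ne fun e => h₂ (by linear_combination -e))
  have key : y ∉ P (i + 1) := by
    intro hy'
    rcases hP.mem_cases hy' with h | h | h | h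
    · exact hy (Or.inr h)
    · exact hy (Or.inl h)
    · exact hyb (by rw [h]; congr 1; ring)
    · exact hya h
  rcases hx with rfl | hx
  · rcases hP.mem_of_petal_adj hxy with h | h
    · rw [add_sub_cancel_right] at h
      rcases hP.mem_of_eq_empty hi h with rfl | rfl | rfl
      · exact hxy.symm
      · exact (hy (Set.mem_insert _ _)).elim
      · exact (hya rfl).elim
    · exact (key h).elim
  · exact (key (hP.mem_of_adj hx hxy)).elim

theorem joined_left_right (hP : IsCyclicCover G F P) (hG : Triconnected G) {R : Set V}
    {i : ZMod F.m} (hR : ∀ w ∈ P i \ F.verts, w ∉ R) (hl : F.petal i ∉ R)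
    (hr : F.petal (i + 1) ∉ R) : Joined G R (F.petal i) (F.petal (i + 1)) := by
  rcases (P i \ F.verts).eq_empty_or_nonempty with h | ⟨x, hx⟩
  · exact .of_adj (hP.petal_adj_petal hG h) hl hr
  · exact (hP.joined_left hG hR hx hl).symm.trans (hP.joined_right hG hR hx hr)

/-- With both adjacent parts empty, the neighbours of q_i are among q_{i-1}, q_{i+1} and `p`;
deleting the first two must leave an edge to `p`. -/
theorem center_adj_petal (hP : IsCyclicCover G F P) (hG : Triconnected G) {i : ZMod F.m}
    (hi : P (i - 1) \ F.verts = ∅) (hi' : P i \ F.verts = ∅) : G.Adj F.center (F.petal i) := by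
  have h₁ := F.one_ne
  have h₂ := F.two_ne
  obtain ⟨x, rfl, y, hy, hya, hyb, hxy⟩ := hG.exists_adj
    (W := {F.petal i}) (a := F.petal (i - 1)) (b := F.petal (i + 1))
    (w := F.petal i) (u := F.center) (F.petal_ne fun e => h₂ (by linear_combination -e)) rfl
    (F.petal_ne fun e => h₁ (by linear_combination -e))
    (F.petal_ne fun e => h₁ (by linear_combination e)) (F.petal_ne_center _).symm
    (F.petal_ne_center _).symm
    (F.petal_ne_center _).symm
  rcases hP.mem_of_petal_adj hxy with h | h
  · rcases hP.mem_of_eq_empty hi h with h | h | rfl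
    · exact (hya h).elim
    · rw [sub_add_cancel] at h
      exact (hy h).elim
    · exact hxy.symm
  · rcases hP.mem_of_eq_empty hi' h with h | h | rfl
    · exact (hy h).elim
    · exact (hyb h).elim
    · exact hxy.symm

theorem not_splits_diff_center (hP : IsCyclicCover G F P) (hG : Triconnected G) {R : Set V}
    {i : ZMod F.m} (hR : ∀ w ∈ P i \ F.verts, w ∉ R)
    (h : F.petal i ∉ R ∨ F.petal (i + 1) ∉ R) : ¬ Splits G R (P i \ {F.center}) := by
  have hlr := hP.joined_left_right hG hR
  rcases h with h | h
  · refine not_splits_of_joined (F.petal i) ?_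
    rintro x ⟨hx, hxc⟩ hxR
    rcases hP.mem_cases hx with hx | rfl | rfl | rfl
    · exact hP.joined_left hG hR hx h
    · exact .refl h
    · exact (hlr h hxR).symm
    · exact (hxc rfl).elim
  · refine not_splits_of_joined (F.petal (i + 1)) ?_
    rintro x ⟨hx, hxc⟩ hxR
    rcases hP.mem_cases hx with hx | rfl | rfl | rfl
    · exact hP.joined_right hG hR hx h
    · exact hlr hxR h
    · exact .refl h
    · exact (hxc rfl).elim

/-- Once the three vertices are removed, the two parts keep only their interiors and q_{j+1}, and
none of these has a neighbour outside the two parts. -/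
theorem separates_Q (hP : IsCyclicCover G F P) {j : ZMod F.m} {x y : V}
    (hx : x ∈ P j ∪ P (j + 1)) (hxQ : x ∉ F.Q j (j + 2)) (hy : y ∉ P j ∪ P (j + 1)) :
    SeparatesVertices G (F.Q j (j + 2)) x y := by
  refine separates_of_closed (W := (P j ∪ P (j + 1)) \ F.Q j (j + 2)) ⟨hx, hxQ⟩ (fun h => hy h.1)
    hxQ ?_ ?_
  · rintro (rfl | rfl | rfl)
    · exact hy (Or.inl (hP.left_mem j))
    · exact hy (Or.inr (hP.petal_mem_iff.2 (Or.inr (by ring))))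
    · exact hy (Or.inl (hP.center_mem j))
  · rintro w ⟨hw, hwQ⟩ v hwv
    by_cases hv : v ∈ F.Q j (j + 2)
    · exact Or.inr hv
    refine Or.inl ⟨?_, hv⟩
    by_cases hwv' : w ∈ F.verts
    · rcases hwv' with rfl | ⟨k, rfl⟩
      · exact (hwQ (Or.inr (Or.inr rfl))).elim
      · have hk : k = j + 1 := by
          rw [F.petal_mem_Q_iff] at hwQ
          rcases hw with hw | hw <;> rw [hP.petal_mem_iff] at hw <;> grind
        subst hk
        have := hP.mem_of_petal_adj hwv
        simpa using this
    · rcases hw with hw | hw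
      · exact Or.inl (hP.mem_of_adj ⟨hw, hwv'⟩ hwv)
      · exact Or.inr (hP.mem_of_adj ⟨hw, hwv'⟩ hwv)

theorem separates_petals (hP : IsCyclicCover G F P) (j : ZMod F.m) :
    SeparatesVertices G (F.Q j (j + 2)) (F.petal (j + 1)) (F.petal (j + 3)) := by
  have h₁ := F.one_ne
  have h₂ := F.two_ne
  have h₃ := F.three_ne
  refine hP.separates_Q (Or.inl (hP.right_mem j)) ?_ ?_
  · rw [F.petal_mem_Q_iff]
    rintro (e | e)
    · exact h₁ (by linear_combination e)
    · exact h₁ (by linear_combination -e)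
  · simp only [Set.mem_union, hP.petal_mem_iff]
    rintro ((e | e) | (e | e))
    · exact h₃ (by linear_combination e)
    · exact h₂ (by linear_combination e)
    · exact h₂ (by linear_combination e)
    · exact h₁ (by linear_combination e)

theorem Q_mem_cutsets3 (hP : IsCyclicCover G F P) (j : ZMod F.m) :
    F.Q j (j + 2) ∈ cutsets3 G :=
  mem_cutsets3_of_separates (F.ncard_Q (by simpa using F.two_ne)) (hP.separates_petals j)

/-- A set split by none of the sets `Q_{j,j+2}` lies in one of the sets `P i`. -/
theorem exists_subset (hP : IsCyclicCover G F P) {A : Set V}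
    (hA : ∀ j, ¬ Splits G (F.Q j (j + 2)) A) : ∃ i, A ⊆ P i := by
  have h₁ := F.one_ne
  have h₂ := F.two_ne
  have h₃ := F.three_ne
  have key : ∀ j, ∀ x ∈ A, x ∈ P j ∪ P (j + 1) → x ∉ F.Q j (j + 2) → A ⊆ P j ∪ P (j + 1) := by
    intro j x hx hxP hxQ y hy
    by_contra hyP
    exact hA j ⟨x, hx, y, hy, hP.separates_Q hxP hxQ hyP⟩
  -- Since m ≥ 4, the two parts flanking `P i` share only `p`. Intersecting two overlapping unions
  -- of consecutive parts therefore leaves one part.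
  have inter : ∀ i, ∀ v ∈ P (i - 1), v ∈ P (i + 1) → v = F.center := by
    intro i v hv hv'
    rcases hP.mem_cases hv with h | rfl | rfl | rfl
    · exact (h₂ (by linear_combination -hP.eq_of_mem v h.2 _ _ hv hv')).elim
    · rcases hP.petal_mem_iff.1 hv' with e | e
      · exact (h₂ (by linear_combination -e)).elim
      · exact (h₃ (by linear_combination -e)).elim
    · rcases hP.petal_mem_iff.1 hv' with e | e
      · exact (h₁ (by linear_combination -e)).elim
      · exact (h₂ (by linear_combination -e)).elim
    · rfl
  by_cases hint : ∃ i, ∃ x ∈ A, x ∈ P i \ F.verts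
  · obtain ⟨i, x, hxA, hx⟩ := hint
    have hA₁ := key i x hxA (Or.inl hx.1) fun h => hx.2 (F.Q_subset_verts _ _ h)
    have hA₂ := key (i - 1) x hxA (Or.inr (by simpa using hx.1))
      fun h => hx.2 (F.Q_subset_verts _ _ h)
    rw [sub_add_cancel] at hA₂
    refine ⟨i, fun y hy => ?_⟩
    rcases hA₁ hy with h | h
    · exact h
    rcases hA₂ hy with h' | h'
    · rw [inter i y h' h]
      exact hP.center_mem i
    · exact h'
  · push Not at hint
    by_cases hpet : ∃ i, F.petal i ∈ A
    · obtain ⟨i, hi⟩ := hpet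
      have hA₁ := key (i - 1) _ hi (Or.inl (by simp [hP.petal_mem_iff]))
        (by
          rw [F.petal_mem_Q_iff]
          rintro (e | e)
          · exact h₁ (by linear_combination e)
          · exact h₁ (by linear_combination -e))
      rw [sub_add_cancel] at hA₁
      by_cases hnext : F.petal (i + 1) ∈ A
      · have hA₂ := key i _ hnext (Or.inl (hP.right_mem i)) (by
          rw [F.petal_mem_Q_iff]
          rintro (e | e)
          · exact h₁ (by linear_combination e)
          · exact h₁ (by linear_combination -e))
        refine ⟨i, fun y hy => ?_⟩
        rcases hA₁ hy with h | h
        · rcases hA₂ hy with h' | h'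
          · exact h'
          · rw [inter i y h h']
            exact hP.center_mem i
        · exact h
      · refine ⟨i - 1, fun y hy => ?_⟩
        rcases hA₁ hy with h | h
        · exact h
        · rcases hP.mem_cases h with h | rfl | rfl | rfl
          · exact (hint i y hy h).elim
          · simp [hP.petal_mem_iff]
          · exact (hnext hy).elim
          · exact hP.center_mem _
    · push Not at hpet
      refine ⟨0, fun y hy => ?_⟩
      rcases hP.cases y with rfl | ⟨i, rfl⟩ | ⟨i, hi⟩
      · exact hP.center_mem _
      · exact (hpet i hy).elim
      · exact (hint i y hy hi).elim

theorem eq_of_subset (hP : IsCyclicCover G F P) {i j : ZMod F.m} (hi : F.petal i ∈ P j)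
    (hi' : F.petal (i + 1) ∈ P j) : i = j := by
  have h₁ := F.one_ne
  have h₂ := F.two_ne
  rw [hP.petal_mem_iff] at hi hi'
  rcases hi with e | e
  · exact e
  · rcases hi' with e' | e'
    · exact (h₂ (by linear_combination e' - e)).elim
    · linear_combination e'

theorem not_splits_of_center_mem (hP : IsCyclicCover G F P) (hG : Triconnected G) {R : Set V}
    {i : ZMod F.m} (hc : F.center ∈ R) (hR : ∀ w ∈ P i \ F.verts, w ∉ R)
    (h : F.petal i ∉ R ∨ F.petal (i + 1) ∉ R) : ¬ Splits G R (P i) := by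
  have := not_splits_iff.1 (hP.not_splits_diff_center hG hR h)
  refine not_splits_iff.2 fun x hx y hy hxR hyR => this x ⟨hx, ?_⟩ y ⟨hy, ?_⟩ hxR hyR
  · rintro rfl; exact hxR hc
  · rintro rfl; exact hyR hc

/-- Converse of `isCyclicCover`, letting a new flower be recognised from a cover alone. The sets
Q_{j,j+2} suffice to generate it: since m ≥ 4, none of them contains two consecutive petals. -/
theorem isFlower (hP : IsCyclicCover G F P) (hG : Triconnected G) : F.IsFlower G := by
  have h₁ := F.one_ne
  have h₂ := F.two_ne
  have h₃ := F.three_ne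
  refine ⟨⟨Set.range fun j => F.Q j (j + 2), ?_, ?_, P, ?_, ?_⟩⟩
  · rintro _ ⟨j, rfl⟩
    exact hP.Q_mem_cutsets3 j
  · rintro _ ⟨j, rfl⟩
    exact ⟨j, j + 2, fun e => h₂ (by linear_combination -e), fun e => h₁ (by linear_combination e),
      fun e => h₃ (by linear_combination -e), rfl⟩
  · refine parts_eq_of_antichain ?_ ?_ ?_
    · rintro _ ⟨i, rfl⟩ _ ⟨j, rfl⟩
      refine hP.not_splits_of_center_mem hG (Or.inr (Or.inr rfl))
        (fun w hw hwQ => hw.2 (F.Q_subset_verts _ _ hwQ)) ?_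
      simp only [F.petal_mem_Q_iff, ← not_and_or]
      rintro ⟨e | e, e' | e'⟩
      · exact h₁ (by linear_combination e' - e)
      · exact h₁ (by linear_combination e - e')
      · exact h₃ (by linear_combination e' - e)
      · exact h₁ (by linear_combination e' - e)
    · rintro _ ⟨i, rfl⟩ _ ⟨j, rfl⟩ h
      rw [hP.eq_of_subset (h (hP.left_mem i)) (h (hP.right_mem i))]
    · intro A hA
      obtain ⟨i, hi⟩ := hP.exists_subset fun j => hA _ ⟨j, rfl⟩
      exact ⟨P i, ⟨i, rfl⟩, hi⟩
  · intro i
    rw [← hP.inter_verts]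
    ext v
    refine and_congr_right fun _ => ⟨?_, ?_⟩
    · rintro ⟨_, ⟨j, rfl⟩, hv⟩
      exact F.Q_subset_verts _ _ hv
    · rintro (rfl | ⟨j, rfl⟩)
      · exact ⟨_, ⟨0, rfl⟩, Or.inr (Or.inr rfl)⟩
      · exact ⟨_, ⟨j, rfl⟩, Or.inl rfl⟩

end IsCyclicCover

/-! ### Inserting a petal, maximality, and connectedness outside one part. -/

namespace IsCyclicCover

variable {F : CyclicTuple V} {P : ZMod F.m → Set V}

theorem natCast_injOn {m a b : ℕ} (ha : 1 ≤ a) (ham : a ≤ m) (hb : 1 ≤ b) (hbm : b ≤ m)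
    (h : (a : ZMod m) = b) : a = b := by
  rw [ZMod.natCast_eq_natCast_iff] at h
  exact h.eq_of_abs_lt (by rw [abs_lt]; constructor <;> omega)

theorem exists_shift {m : ℕ} [NeZero m] {i j : ZMod m} (h : j ≠ i) :
    ∃ n : ℕ, 1 ≤ n ∧ n < m ∧ j = i + n := by
  refine ⟨(j - i).val, ?_, ZMod.val_lt _, by simp⟩
  rw [Nat.one_le_iff_ne_zero, Ne, ZMod.val_eq_zero]
  exact sub_ne_zero.2 h

theorem cases_succ {m : ℕ} (k : ZMod (m + 1)) :
    k = 0 ∨ k = (m : ℕ) ∨ ∃ n : ℕ, 1 ≤ n ∧ n < m ∧ k = n := by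
  have hk : ((k.val : ℕ) : ZMod (m + 1)) = k := by simp
  have hlt := ZMod.val_lt k
  by_cases h₀ : k.val = 0
  · exact Or.inl ((ZMod.val_eq_zero k).1 h₀)
  · by_cases h₁ : k.val = m
    · exact Or.inr (Or.inl (by rw [← hk, h₁]))
    · exact Or.inr (Or.inr ⟨k.val, by omega, by omega, hk.symm⟩)

/-- If `P i` is the union of two sets with common part `{p, x}`, no edge joining the rest of one to
the rest of the other, then `x` can be inserted into `F` as a petal between `q_i` and
`q_{i+1}`. -/
theorem exists_insert (hP : IsCyclicCover G F P) {i : ZMod F.m} {x : V}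
    (hx : x ∈ P i \ F.verts) {A B : Set V} (hA : A ⊆ P i) (hB : B ⊆ P i)
    (hAB : A ∩ B = {x, F.center}) (hlA : F.petal i ∈ A) (hrB : F.petal (i + 1) ∈ B)
    (hcov : P i ⊆ A ∪ B)
    (hadj : ∀ v ∈ P i, ∀ w ∈ P i, G.Adj v w → v ∈ A ∧ w ∈ A ∨ v ∈ B ∧ w ∈ B) :
    ∃ (F' : CyclicTuple V) (P' : ZMod F'.m → Set V), F'.center = F.center ∧
      F'.verts = insert x F.verts ∧ IsCyclicCover G F' P' := by
  classical
  have hm := F.four_le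
  have : NeZero F.m := ⟨by omega⟩
  have hxc : x ≠ F.center := fun h => hx.2 (h ▸ F.center_mem_verts)
  have hxp : ∀ j, x ≠ F.petal j := fun j h => hx.2 (h ▸ F.petal_mem_verts j)
  have hxAB : x ∈ A ∩ B := hAB ▸ Or.inl rfl
  have hcAB : F.center ∈ A ∩ B := hAB ▸ Or.inr rfl
  have hlB : F.petal i ∉ B := by
    intro h
    have : F.petal i ∈ A ∩ B := ⟨hlA, h⟩
    rw [hAB] at this
    rcases this with h | h
    exacts [hxp _ h.symm, F.petal_ne_center _ h]
  have hrA : F.petal (i + 1) ∉ A := by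
    intro h
    have : F.petal (i + 1) ∈ A ∩ B := ⟨h, hrB⟩
    rw [hAB] at this
    rcases this with h | h
    exacts [hxp _ h.symm, F.petal_ne_center _ h]
  -- The new petal gets index 0 and q_{i+n} gets index n for 1 ≤ n ≤ m, so q_i has index m. Thus `x`
  -- stands between q_i and q_{i+1}, with `A` as part m and `B` as part 0.
  let pet : ZMod (F.m + 1) → V := fun k => if k = 0 then x else F.petal (i + (k.val : ℕ))
  let P' : ZMod (F.m + 1) → Set V := fun k =>
    if k = 0 then B else if k = (F.m : ℕ) then A else P (i + (k.val : ℕ))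
  have hval : ∀ n ≤ F.m, ((n : ℕ) : ZMod (F.m + 1)).val = n := fun n hn =>
    ZMod.val_natCast_of_lt (by omega)
  have hne : ∀ n, 1 ≤ n → n ≤ F.m → ((n : ℕ) : ZMod (F.m + 1)) ≠ 0 := by
    intro n hn hn' h
    have := hval n hn'
    rw [h, ZMod.val_zero] at this
    omega
  have hpet₀ : pet 0 = x := if_pos rfl
  have hpet : ∀ n : ℕ, 1 ≤ n → n ≤ F.m → pet n = F.petal (i + n) := by
    intro n hn hn'
    simp only [pet, if_neg (hne n hn hn'), hval n hn']
  have hP₀ : P' 0 = B := if_pos rfl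
  have hPm : P' (F.m : ℕ) = A := by
    simp only [P', if_neg (hne F.m (by omega) le_rfl), if_true]
  have hPn : ∀ n : ℕ, 1 ≤ n → n < F.m → P' n = P (i + n) := by
    intro n hn hn'
    have : ((n : ℕ) : ZMod (F.m + 1)) ≠ (F.m : ℕ) := by
      intro h
      have := congrArg ZMod.val h
      rw [hval _ hn'.le, hval _ le_rfl] at this
      omega
    simp only [P', if_neg (hne n hn hn'.le), if_neg this, hval n hn'.le]
  have hpm : pet (F.m : ℕ) = F.petal i := by
    rw [hpet F.m (by omega) le_rfl]
    simp
  have hshift : ∀ n : ℕ, 1 ≤ n → n < F.m → i + (n : ZMod F.m) ≠ i := by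
    intro n hn hn' h
    exact F.natCast_ne_zero (by omega) hn' (by linear_combination h)
  have hpet_cases : ∀ k, pet k = x ∧ k = 0 ∨
      ∃ n : ℕ, 1 ≤ n ∧ n ≤ F.m ∧ k = n ∧ pet k = F.petal (i + n) := by
    intro k
    rcases cases_succ k with rfl | rfl | ⟨n, h₁, h₂, rfl⟩
    · exact Or.inl ⟨hpet₀, rfl⟩
    · exact Or.inr ⟨F.m, by omega, le_rfl, rfl, hpet _ (by omega) le_rfl⟩
    · exact Or.inr ⟨n, h₁, h₂.le, rfl, hpet n h₁ h₂.le⟩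
  have hrange : ∀ j, F.petal j ∈ Set.range pet := by
    intro j
    by_cases hj : j = i
    · exact ⟨(F.m : ℕ), by rw [hpm, hj]⟩
    · obtain ⟨n, h₁, h₂, rfl⟩ := exists_shift hj
      exact ⟨n, hpet n h₁ h₂.le⟩
  let F' : CyclicTuple V :=
    { m := F.m + 1
      four_le := by omega
      center := F.center
      petal := pet
      petal_injective := by
        intro k l hkl
        rcases hpet_cases k with ⟨hk, hk'⟩ | ⟨a, ha, ha', hk', hk⟩ <;>
          rcases hpet_cases l with ⟨hl, hl'⟩ | ⟨b, hb, hb', hl', hl⟩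
        · rw [hk', hl']
        · exact (hxp _ (hk.symm.trans (hkl.trans hl))).elim
        · exact (hxp _ (hl.symm.trans (hkl.symm.trans hk))).elim
        · rw [hk, hl] at hkl
          rw [hk', hl', natCast_injOn ha ha' hb hb' (add_left_cancel (F.petal_injective hkl))]
      petal_ne_center := by
        intro k
        rcases hpet_cases k with ⟨hk, rfl⟩ | ⟨a, ha, ha', rfl, hk⟩ <;> rw [hk]
        · exact hxc
        · exact F.petal_ne_center _ }
  have hverts : F'.verts = insert x F.verts := by
    ext v
    constructor
    · rintro (rfl | ⟨k, rfl⟩)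
      · exact Or.inr F.center_mem_verts
      · rcases hpet_cases k with ⟨hk, rfl⟩ | ⟨a, ha, ha', rfl, hk⟩
        · exact Or.inl hk
        · exact Or.inr (by change pet a ∈ _; rw [hk]; exact F.petal_mem_verts _)
    · rintro (rfl | rfl | ⟨j, rfl⟩)
      · exact Or.inr ⟨0, hpet₀⟩
      · exact Or.inl rfl
      · exact Or.inr (hrange j)
  have hPj : ∀ j ≠ i, ∃ k, P' k = P j := by
    intro j hj
    obtain ⟨n, h₁, h₂, rfl⟩ := exists_shift hj
    exact ⟨n, hPn n h₁ h₂⟩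
  refine ⟨F', P', rfl, hverts, ?_, ?_, ?_, ?_⟩
  · intro v
    obtain ⟨j, hj⟩ := hP.cover v
    by_cases hji : j = i
    · subst hji
      rcases hcov hj with h | h
      · exact ⟨(F.m : ℕ), hPm ▸ h⟩
      · exact ⟨0, hP₀ ▸ h⟩
    · obtain ⟨k, hk⟩ := hPj j hji
      exact ⟨k, hk ▸ hj⟩
  · intro v w hvw
    obtain ⟨j, hj, hj'⟩ := hP.adj v w hvw
    by_cases hji : j = i
    · subst hji
      rcases hadj v hj w hj' hvw with h | h
      · exact ⟨(F.m : ℕ), hPm ▸ h⟩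
      · exact ⟨0, hP₀ ▸ h⟩
    · obtain ⟨k, hk⟩ := hPj j hji
      exact ⟨k, hk ▸ ⟨hj, hj'⟩⟩
  · intro k
    rw [hverts]
    ext v
    change v ∈ P' k ∩ insert x F.verts ↔ v = pet k ∨ v = pet (k + 1) ∨ v = F.center
    rcases cases_succ k with rfl | rfl | ⟨n, h₁, h₂, rfl⟩
    · have h1 : pet (0 + 1) = F.petal (i + 1) := by
        have := hpet 1 le_rfl (by omega)
        simpa using this
      rw [hP₀, hpet₀, h1]
      constructor
      · rintro ⟨hv, rfl | hv'⟩
        · exact Or.inl rfl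
        · rcases hP.mem_cases (hB hv) with h | rfl | rfl | rfl
          · exact (h.2 hv').elim
          · exact (hlB hv).elim
          · exact Or.inr (Or.inl rfl)
          · exact Or.inr (Or.inr rfl)
      · rintro (rfl | rfl | rfl)
        · exact ⟨hxAB.2, Or.inl rfl⟩
        · exact ⟨hrB, Or.inr (F.petal_mem_verts _)⟩
        · exact ⟨hcAB.2, Or.inr F.center_mem_verts⟩
    · have h1 : pet (((F.m : ℕ) : ZMod (F.m + 1)) + 1) = x := by
        have : ((F.m : ℕ) : ZMod (F.m + 1)) + 1 = 0 := by
          have := ZMod.natCast_self (F.m + 1)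
          push_cast at this
          exact this
        rw [this, hpet₀]
      rw [hPm, hpm, h1]
      constructor
      · rintro ⟨hv, rfl | hv'⟩
        · exact Or.inr (Or.inl rfl)
        · rcases hP.mem_cases (hA hv) with h | rfl | rfl | rfl
          · exact (h.2 hv').elim
          · exact Or.inl rfl
          · exact (hrA hv).elim
          · exact Or.inr (Or.inr rfl)
      · rintro (rfl | rfl | rfl)
        · exact ⟨hlA, Or.inr (F.petal_mem_verts _)⟩
        · exact ⟨hxAB.1, Or.inl rfl⟩
        · exact ⟨hcAB.1, Or.inr F.center_mem_verts⟩
    · have h1 : pet (((n : ℕ) : ZMod (F.m + 1)) + 1) = F.petal (i + n + 1) := by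
        have := hpet (n + 1) (by omega) (by omega)
        push_cast at this
        rw [this, add_assoc]
      rw [hPn n h₁ h₂, hpet n h₁ h₂.le, h1, ← mem_Q_iff, ← hP.inter_verts]
      constructor
      · rintro ⟨hv, rfl | hv'⟩
        · exact (hshift n h₁ h₂ (hP.eq_of_mem v hx.2 _ _ hv hx.1)).elim
        · exact ⟨hv, hv'⟩
      · rintro ⟨hv, hv'⟩
        exact ⟨hv, Or.inr hv'⟩
  · intro v hv
    rw [hverts] at hv
    have hvx : v ≠ x := fun h => hv (Or.inl h)
    have hvF : v ∉ F.verts := fun h => hv (Or.inr h)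
    have hnotAB : v ∈ A → v ∈ B → False := by
      intro h h'
      have : v ∈ A ∩ B := ⟨h, h'⟩
      rw [hAB] at this
      rcases this with h | h
      · exact hvx h
      · exact hvF (h ▸ F.center_mem_verts)
    have hnot : ∀ n : ℕ, 1 ≤ n → n < F.m → v ∈ P (i + n) → v ∈ P i → False :=
      fun n h₁ h₂ h h' => hshift n h₁ h₂ (hP.eq_of_mem v hvF _ _ h h')
    intro k l hk hl
    rcases cases_succ k with rfl | rfl | ⟨n, h₁, h₂, rfl⟩ <;>
      rcases cases_succ l with rfl | rfl | ⟨n', h₁', h₂', rfl⟩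
    · rfl
    · rw [hP₀] at hk
      rw [hPm] at hl
      exact (hnotAB hl hk).elim
    · rw [hP₀] at hk
      rw [hPn _ h₁' h₂'] at hl
      exact (hnot _ h₁' h₂' hl (hB hk)).elim
    · rw [hPm] at hk
      rw [hP₀] at hl
      exact (hnotAB hk hl).elim
    · rfl
    · rw [hPm] at hk
      rw [hPn _ h₁' h₂'] at hl
      exact (hnot _ h₁' h₂' hl (hA hk)).elim
    · rw [hPn _ h₁ h₂] at hk
      rw [hP₀] at hl
      exact (hnot _ h₁ h₂ hk (hB hl)).elim
    · rw [hPn _ h₁ h₂] at hk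
      rw [hPm] at hl
      exact (hnot _ h₁ h₂ hk (hA hl)).elim
    · rw [hPn _ h₁ h₂] at hk
      rw [hPn _ h₁' h₂'] at hl
      rw [natCast_injOn h₁ h₂.le h₁' h₂'.le (add_left_cancel (hP.eq_of_mem v hvF _ _ hk hl))]

/-- In a maximal flower no inner vertex of `P i` separates `q_i` from `q_{i+1}` in `P i \ {p}`. -/
theorem joined_of_isMaximalFlower (hP : IsCyclicCover G F P) (hG : Triconnected G)
    (hF : F.IsMaximalFlower G) {R : Set V} {i : ZMod F.m} {x : V} (hx : x ∈ P i \ F.verts)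
    (hR : ∀ w ∈ P i \ F.verts, w ∈ R → w = x) (hl : F.petal i ∉ R) (hr : F.petal (i + 1) ∉ R) :
    Joined G R (F.petal i) (F.petal (i + 1)) := by
  by_contra hJ
  have hxc : x ≠ F.center := fun h => hx.2 (h ▸ F.center_mem_verts)
  have hR' : ∀ w ∈ P i, w ≠ x → w ≠ F.center → w ∉ R := by
    intro w hw hwx hwc hwR
    rcases hP.mem_cases hw with h | rfl | rfl | rfl
    · exact hwx (hR w h hwR)
    · exact hl hwR
    · exact hr hwR
    · exact hwc rfl
  -- `B` collects the vertices of the part joined to q_{i+1} off `R`, and `A` the others; `x` and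
  -- `p` go into both, whether or not they lie in `R`.
  obtain ⟨F', P', hc, hv, hP'⟩ := hP.exists_insert hx
    (A := {w | w ∈ P i ∧ (w = x ∨ w = F.center ∨ ¬ Joined G R w (F.petal (i + 1)))})
    (B := {w | w ∈ P i ∧ (w = x ∨ w = F.center ∨ Joined G R w (F.petal (i + 1)))})
    (fun _ h => h.1) (fun _ h => h.1)
    (by
      ext w
      constructor
      · rintro ⟨⟨-, h⟩, -, h'⟩
        change w = x ∨ w = F.center
        tauto
      · rintro (rfl | rfl)
        · exact ⟨⟨hx.1, Or.inl rfl⟩, ⟨hx.1, Or.inl rfl⟩⟩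
        · exact ⟨⟨hP.center_mem i, Or.inr (Or.inl rfl)⟩, ⟨hP.center_mem i, Or.inr (Or.inl rfl)⟩⟩)
    ⟨hP.left_mem i, Or.inr (Or.inr hJ)⟩ ⟨hP.right_mem i, Or.inr (Or.inr (.refl hr))⟩
    (fun w hw => by
      by_cases h : Joined G R w (F.petal (i + 1))
      · exact Or.inr ⟨hw, Or.inr (Or.inr h)⟩
      · exact Or.inl ⟨hw, Or.inr (Or.inr h)⟩)
    (fun v hv w hw hvw => by
      simp only [Set.mem_ofPred_eq, hv, hw, true_and]
      by_cases h₁ : v = x ∨ v = F.center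
      · by_cases h : Joined G R w (F.petal (i + 1)) <;> tauto
      by_cases h₂ : w = x ∨ w = F.center
      · by_cases h : Joined G R v (F.petal (i + 1)) <;> tauto
      push Not at h₁ h₂
      have hJ' : Joined G R v w := .of_adj hvw (hR' v hv h₁.1 h₁.2) (hR' w hw h₂.1 h₂.2)
      by_cases h : Joined G R v (F.petal (i + 1))
      · have := hJ'.symm.trans h
        tauto
      · have : ¬ Joined G R w (F.petal (i + 1)) := fun h' => h (hJ'.trans h')
        tauto)
  have := hF.2 F' (hP'.isFlower hG) hc (by rw [hv]; exact Set.subset_insert _ _)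
  rw [hv] at this
  exact hx.2 (this ▸ Set.mem_insert _ _)

/-- If `R` lies in `P i`, then all petals outside `P i` lie in one component of `G - R`. -/
theorem joined_petals (hP : IsCyclicCover G F P) (hG : Triconnected G) {R : Set V}
    {i : ZMod F.m} (hR : R ⊆ P i) {k : ZMod F.m} (hk : F.petal k ∉ P i) :
    Joined G R (F.petal k) (F.petal (i + 2)) := by
  have hm := F.four_le
  have : NeZero F.m := ⟨by omega⟩
  have hpetal : ∀ n : ℕ, 2 ≤ n → n < F.m → F.petal (i + n) ∉ P i := by
    intro n h₁ h₂ h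
    rcases hP.petal_mem_iff.1 h with e | e
    · exact F.natCast_ne_zero (by omega) h₂ (by linear_combination e)
    · refine F.natCast_ne_zero (n := n - 1) (by omega) (by omega) ?_
      push_cast [show 1 ≤ n by omega]
      linear_combination e
  -- Walk along q_{i+2}, …, q_{i+m-1}: the parts between consecutive petals of this list have
  -- interiors disjoint from `R`.
  have key : ∀ n : ℕ, n + 2 < F.m →
      Joined G R (F.petal (i + ((n + 2 : ℕ) : ZMod F.m))) (F.petal (i + 2)) := by
    intro n
    induction n with
    | zero =>
      intro h
      have := hpetal 2 le_rfl h
      have h₂ : ((0 + 2 : ℕ) : ZMod F.m) = 2 := by norm_num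
      rw [h₂]
      exact .refl fun h' => this (by exact_mod_cast hR h')
    | succ n ih =>
      intro h
      refine Joined.trans ?_ (ih (by omega))
      have e : i + ((n + 1 + 2 : ℕ) : ZMod F.m) = i + ((n + 2 : ℕ) : ZMod F.m) + 1 := by
        push_cast
        ring
      have h₁ := hpetal (n + 2) (by omega) (by omega)
      have h₂ := hpetal (n + 1 + 2) (by omega) h
      rw [e] at h₂ ⊢
      refine (hP.joined_left_right hG ?_ (fun h => h₁ (hR h)) (fun h => h₂ (hR h))).symm
      intro w hw hwR
      have := hP.eq_of_mem w hw.2 _ _ hw.1 (hR hwR)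
      rw [this] at h₁
      exact h₁ (hP.left_mem i)
  have hki : k ≠ i := by
    rintro rfl
    exact hk (hP.left_mem k)
  obtain ⟨n, h₁, h₂, rfl⟩ := exists_shift hki
  have h₃ : n ≠ 1 := by
    rintro rfl
    exact hk (by simpa using hP.right_mem i)
  have := key (n - 2) (by omega)
  rwa [show n - 2 + 2 = n by omega] at this

/-- If `R` lies in `P i`, then all vertices outside `P i` lie in one component of `G - R`. -/
theorem joined_of_notMem (hP : IsCyclicCover G F P) (hG : Triconnected G) {R : Set V}
    {i : ZMod F.m} (hR : R ⊆ P i) {v : V} (hv : v ∉ P i) : Joined G R v (F.petal (i + 2)) := by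
  rcases hP.cases v with rfl | ⟨k, rfl⟩ | ⟨j, hj⟩
  · exact (hv (hP.center_mem i)).elim
  · exact hP.joined_petals hG hR hv
  · have hji : j ≠ i := by
      rintro rfl
      exact hv hj.1
    have hR' : ∀ w ∈ P j \ F.verts, w ∉ R :=
      fun w hw h => hji (hP.eq_of_mem w hw.2 _ _ hw.1 (hR h))
    by_cases hl : F.petal j ∈ P i
    · have hr : F.petal (j + 1) ∉ P i := fun hr => hji (hP.eq_of_subset hl hr)
      exact (hP.joined_right hG hR' hj fun h => hr (hR h)).trans (hP.joined_petals hG hR hr)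
    · exact (hP.joined_left hG hR' hj fun h => hl (hR h)).trans (hP.joined_petals hG hR hl)

end IsCyclicCover

end CyclicTuple

/-! ### Neighbours of the center, and nondegeneracy. -/

theorem SeparatesVertices.symm {R : Set V} {x y : V} (h : SeparatesVertices G R x y) :
    SeparatesVertices G R y x := by
  rw [separates_iff] at h ⊢
  exact ⟨h.2.1, h.1, fun h' => h.2.2 h'.symm⟩

theorem mem_of_reachable_of_closed {W : Set V} {x y : V} (h : G.Reachable x y) (hx : x ∈ W)
    (hW : ∀ w ∈ W, ∀ v, G.Adj w v → v ∈ W) : y ∈ W := by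
  rw [SimpleGraph.reachable_iff_reflTransGen] at h
  induction h with
  | refl => exact hx
  | tail _ hadj ih => exact hW _ ih _ hadj

namespace CyclicTuple

variable {F : CyclicTuple V}

namespace IsCyclicCover

variable {P : ZMod F.m → Set V}

/-- Deleting q_i and q_{i+1} leaves the graph connected, and interior vertices have no neighbours
outside the part, so only `p` can provide the exit. -/
theorem exists_adj_center_notMem (hP : IsCyclicCover G F P) (hG : Triconnected G)
    (i : ZMod F.m) : ∃ y, y ∉ P i ∧ G.Adj F.center y := by
  have hpet : F.petal (i + 2) ∉ P i := by
    rw [hP.petal_mem_iff]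
    rintro (e | e)
    · exact F.two_ne (by linear_combination e)
    · exact F.one_ne (by linear_combination e)
  obtain ⟨x, hx, y, hy, hyl, hyr, hxy⟩ := hG.exists_adj
    (W := P i \ {F.petal i, F.petal (i + 1)}) (w := F.center) (u := F.petal (i + 2))
    (left_ne_right F i)
    ⟨hP.center_mem i, by
      rintro (h | h)
      exacts [F.petal_ne_center _ h.symm, F.petal_ne_center _ h.symm]⟩
    (fun h => h.2 (Or.inl rfl)) (fun h => h.2 (Or.inr rfl)) (fun h => hpet h.1)
    (fun h => hpet (h ▸ hP.left_mem i)) (fun h => hpet (h ▸ hP.right_mem i))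
  have hy' : y ∉ P i := by
    intro h
    refine hy ⟨h, ?_⟩
    rintro (h | h)
    exacts [hyl h, hyr h]
  refine ⟨y, hy', ?_⟩
  rcases hP.mem_cases hx.1 with h | rfl | rfl | rfl
  · exact (hy' (hP.mem_of_adj h hxy)).elim
  · exact (hx.2 (Or.inl rfl)).elim
  · exact (hx.2 (Or.inr rfl)).elim
  · exact hxy

/-- If the center has three neighbours, then in a nondegenerate flower it has at most one neighbour
in every nonempty `P j`. -/
theorem eq_of_adj_center [Finite V] (hP : IsCyclicCover G F P) (hG : Triconnected G)
    (hnd : F.IsNondegenerate G) (hs : F.IsSingular G) {j : ZMod F.m} {x₁ x₂ : V}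
    (hx₁ : x₁ ∈ P j \ F.verts) (h₁ : G.Adj F.center x₁) (hx₂ : x₂ ∈ P j)
    (h₂ : G.Adj F.center x₂) : x₂ = x₁ := by
  by_contra hne
  have n₁ := F.one_ne
  have n₂ := F.two_ne
  have n₃ := F.three_ne
  obtain ⟨y, hy, hyN⟩ : ∃ y, G.Adj F.center y ∧
      ∀ v, G.Adj F.center v → v = x₁ ∨ v = x₂ ∨ v = y := by
    have hsub : ({x₁, x₂} : Set V) ⊆ G.neighborSet F.center := by
      rintro v (rfl | rfl)
      exacts [h₁, h₂]
    have hcard : (G.neighborSet F.center \ {x₁, x₂}).ncard = 1 := by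
      have hs' : (G.neighborSet F.center).ncard = 3 := hs
      rw [Set.ncard_sdiff hsub, hs', Set.ncard_pair (Ne.symm hne)]
    obtain ⟨y, hy⟩ := Set.ncard_eq_one.1 hcard
    have hy' : y ∈ G.neighborSet F.center \ {x₁, x₂} := hy ▸ rfl
    refine ⟨y, hy'.1, fun v hv => ?_⟩
    by_contra! hv'
    have : v ∈ G.neighborSet F.center \ {x₁, x₂} := ⟨hv, by
      rintro (h | h)
      exacts [hv'.1 h, hv'.2.1 h]⟩
    rw [hy] at this
    exact hv'.2.2 this
  -- Besides `x₁` and `x₂` the center has a single neighbour `y`, which must serve every other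
  -- nonempty part.
  have hint : ∀ l ≠ j, (P l \ F.verts).Nonempty → y ∈ P l \ F.verts := by
    intro l hl hne'
    obtain ⟨w, hw, hpw⟩ := hP.exists_adj_center hG hne'
    rcases hyN w hpw with rfl | rfl | rfl
    · exact (hl (hP.eq_of_mem w hw.2 _ _ hw.1 hx₁.1)).elim
    · exact (hl (hP.eq_of_mem w hw.2 _ _ hw.1 hx₂)).elim
    · exact hw
  have hpet : ∀ k, k ≠ j → k ≠ j + 1 →
      y = F.petal k ∨ y ∈ P (k - 1) \ F.verts ∨ y ∈ P k \ F.verts := by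
    intro k hk hk'
    rcases (P (k - 1) \ F.verts).eq_empty_or_nonempty with he | he
    · rcases (P k \ F.verts).eq_empty_or_nonempty with he' | he'
      · rcases hyN _ (hP.center_adj_petal hG he he') with h | h | h
        · exact (hx₁.2 (h ▸ F.petal_mem_verts k)).elim
        · rw [← h] at hx₂
          rcases hP.petal_mem_iff.1 hx₂ with h | h
          exacts [(hk h).elim, (hk' h).elim]
        · exact Or.inl h.symm
      · exact Or.inr (Or.inr (hint k hk he'))
    · exact Or.inr (Or.inl (hint _ (fun e => hk' (by linear_combination e)) he))
  have hA := hpet (j + 2) (fun e => n₂ (by linear_combination e))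
    (fun e => n₁ (by linear_combination e))
  have hB := hpet (j - 1) (fun e => n₁ (by linear_combination -e))
    (fun e => n₂ (by linear_combination -e))
  -- The conditions at q_{j+2} and q_{j-1} are compatible only if parts j+2 and j-2 coincide and `y`
  -- is interior to that part. This forces m = 4, with parts j-1 and j+1 empty.
  have hyint : y ∈ P (j + 2) \ F.verts := by
    rcases hA with rfl | h | h
    · rcases hB with h | h | h
      · exact (n₃ (by linear_combination F.petal_injective h)).elim
      · exact (h.2 (F.petal_mem_verts _)).elim
      · exact (h.2 (F.petal_mem_verts _)).elim
    · rcases hB with rfl | h' | h'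
      · exact (h.2 (F.petal_mem_verts _)).elim
      · exact (n₃ (by linear_combination hP.eq_of_mem y h.2 _ _ h.1 h'.1)).elim
      · exact (n₂ (by linear_combination hP.eq_of_mem y h.2 _ _ h.1 h'.1)).elim
    · exact h
  have hyeq : ∀ l, y ∈ P l \ F.verts → l = j + 2 :=
    fun l hl => hP.eq_of_mem y hl.2 _ _ hl.1 hyint.1
  have hyp : ∀ k, y ≠ F.petal k := fun k h => hyint.2 (h ▸ F.petal_mem_verts k)
  have hj3 : j + 2 + 1 = j - 1 := by
    rcases hB with h | h | h
    · exact (hyp _ h).elim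
    · linear_combination -hyeq _ h
    · exact (n₃ (by linear_combination -hyeq _ h)).elim
  have hl : P (j - 1) \ F.verts = ∅ := by
    by_contra h
    have := hyeq _ (hint (j - 1) (fun e => n₁ (by linear_combination -e))
      (Set.nonempty_iff_ne_empty.2 h))
    exact n₃ (by linear_combination -this)
  have hr : P (j + 1) \ F.verts = ∅ := by
    by_contra h
    have := hyeq _ (hint (j + 1) (fun e => n₁ (by linear_combination e))
      (Set.nonempty_iff_ne_empty.2 h))
    exact n₁ (by linear_combination -this)
  have el : G.Adj (F.petal j) (F.petal (j - 1)) := by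
    have := hP.petal_adj_petal hG hl
    rw [sub_add_cancel] at this
    exact this.symm
  have er : G.Adj (F.petal (j + 1)) (F.petal (j + 2)) := by
    have := hP.petal_adj_petal hG hr
    rwa [add_assoc, one_add_one_eq_two] at this
  -- These are the only edges from part j to the rest of the graph, and their ends cover `p` and all
  -- four petals, contradicting nondegeneracy.
  let M : Set (Sym2 V) :=
    {s(F.petal j, F.petal (j - 1)), s(F.petal (j + 1), F.petal (j + 2)), s(F.center, y)}
  refine hnd M ⟨?_, ?_, ?_⟩ ?_
  · rintro _ (rfl | rfl | rfl)
    exacts [el, er, hy]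
  · refine ncard_triple ?_ ?_ ?_
    · rw [Ne, Sym2.eq_iff]
      rintro (⟨h, -⟩ | ⟨h, -⟩)
      · exact n₁ (by linear_combination -F.petal_injective h)
      · exact n₂ (by linear_combination -F.petal_injective h)
    · rw [Ne, Sym2.eq_iff]
      rintro (⟨h, -⟩ | ⟨-, h⟩)
      exacts [F.petal_ne_center _ h, F.petal_ne_center _ h]
    · rw [Ne, Sym2.eq_iff]
      rintro (⟨h, -⟩ | ⟨-, h⟩)
      exacts [F.petal_ne_center _ h, F.petal_ne_center _ h]
  · intro hcon
    have hmem : F.petal (j + 2) ∈ P j := by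
      refine mem_of_reachable_of_closed (hcon F.center (F.petal (j + 2))) (hP.center_mem j) ?_
      intro w hw v hwv
      rw [SimpleGraph.deleteEdges_adj] at hwv
      obtain ⟨hwv, hM⟩ := hwv
      rcases hP.mem_cases hw with h | rfl | rfl | rfl
      · exact hP.mem_of_adj h hwv
      · rcases hP.mem_of_petal_adj hwv with h | h
        · rcases hP.mem_of_eq_empty hl h with rfl | rfl | rfl
          · exact (hM (Or.inl rfl)).elim
          · rw [sub_add_cancel]
            exact hP.left_mem j
          · exact hP.center_mem j
        · exact h
      · rcases hP.mem_of_petal_adj hwv with h | h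
        · rwa [add_sub_cancel_right] at h
        · rcases hP.mem_of_eq_empty hr h with rfl | rfl | rfl
          · exact hP.right_mem j
          · exact (hM (Or.inr (Or.inl (by rw [add_assoc, one_add_one_eq_two])))).elim
          · exact hP.center_mem j
      · rcases hyN v hwv with rfl | rfl | rfl
        · exact hx₁.1
        · exact hx₂
        · exact (hM (Or.inr (Or.inr rfl))).elim
    rcases hP.petal_mem_iff.1 hmem with e | e
    · exact n₂ (by linear_combination e)
    · exact n₁ (by linear_combination e)
  · rintro v (rfl | ⟨k, rfl⟩)
    · exact ⟨_, Or.inr (Or.inr rfl), Sym2.mem_mk_left _ _⟩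
    · by_cases hk : k = j
      · subst hk
        exact ⟨_, Or.inl rfl, Sym2.mem_mk_left _ _⟩
      by_cases hk' : k = j + 1
      · subst hk'
        exact ⟨_, Or.inr (Or.inl rfl), Sym2.mem_mk_left _ _⟩
      rcases hpet k hk hk' with h | h | h
      · exact (hyp k h).elim
      · have : k = j - 1 := by linear_combination hyeq _ h + hj3
        subst this
        exact ⟨_, Or.inl rfl, Sym2.mem_mk_right _ _⟩
      · have : k = j + 2 := hyeq _ h
        subst this
        exact ⟨_, Or.inr (Or.inl rfl), Sym2.mem_mk_right _ _⟩

end IsCyclicCover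

/-! ### The vertices u_{i,i+1} and the members of the complex. -/

namespace Generation

theorem u_cases (D : Generation G F) {i : ZMod F.m} (h : D.u i ≠ F.center) :
    (D.u i ∈ D.part i ∧ G.Adj F.center (D.u i)) ∧
      (∀ y ∈ D.part i, G.Adj F.center y → y = D.u i) ∧
      ((F.IsSingular G ∧ (D.inner i).Nonempty) ∨
        (¬ F.IsSingular G ∧ D.inner (i - 1) = ∅ ∧ D.inner (i + 1) = ∅)) := by
  by_cases hc : (∃! x, x ∈ D.part i ∧ G.Adj F.center x) ∧
      ((F.IsSingular G ∧ (D.inner i).Nonempty) ∨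
        (¬ F.IsSingular G ∧ D.inner (i - 1) = ∅ ∧ D.inner (i + 1) = ∅))
  · have hu : D.u i = hc.1.choose := dif_pos hc
    have hspec := hc.1.choose_spec
    rw [← hu] at hspec
    exact ⟨hspec.1, fun y hy hy' => hspec.2 y ⟨hy, hy'⟩, hc.2⟩
  · exact (h (dif_neg hc)).elim

theorem eq_u_of_adj (D : Generation G F) {i : ZMod F.m} (h : D.u i ≠ F.center) {y : V}
    (hy : y ∈ D.part i) (hpy : G.Adj F.center y) : y = D.u i :=
  (D.u_cases h).2.1 y hy hpy

theorem center_adj_u (D : Generation G F) {i : ZMod F.m} (h : D.u i ≠ F.center) :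
    G.Adj F.center (D.u i) :=
  (D.u_cases h).1.2

theorem mem_complex (D : Generation G F) {R : Set V} {i : ZMod F.m} (hR : R.ncard = 3)
    (hR' : R ⊆ D.nbhd) (h : SeparatesVertices G R (F.petal i) F.center) : R ∈ D.complex :=
  ⟨mem_cutsets3_of_separates hR h, hR', F.petal i, Or.inl (F.petal_mem_verts _), F.center,
    Or.inl F.center_mem_verts, h⟩

variable [Finite V]

/-- In the nonsingular case the adjacent parts are empty. If this one were empty too, `p` would be
adjacent to both its petals, against uniqueness of the neighbour. -/
theorem inner_nonempty (D : Generation G F) (hG : Triconnected G) {i : ZMod F.m}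
    (h : D.u i ≠ F.center) : (D.inner i).Nonempty := by
  rcases (D.u_cases h).2.2 with h' | ⟨-, hl, hr⟩
  · exact h'.2
  · by_contra hne
    have hP := D.isCyclicCover
    rw [Set.not_nonempty_iff_eq_empty] at hne
    rw [D.inner_eq] at hl hr hne
    have h₁ := D.eq_u_of_adj h (hP.left_mem i) (hP.center_adj_petal hG hl hne)
    have h₂ := D.eq_u_of_adj h (hP.right_mem i)
      (hP.center_adj_petal hG (by rwa [add_sub_cancel_right]) hr)
    exact IsCyclicCover.left_ne_right F i (h₁.trans h₂.symm)

theorem u_mem (D : Generation G F) (hG : Triconnected G) {i : ZMod F.m}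
    (h : D.u i ≠ F.center) : D.u i ∈ D.part i \ F.verts := by
  have hne := D.inner_nonempty hG h
  rw [D.inner_eq] at hne
  obtain ⟨w, hw, hpw⟩ := D.isCyclicCover.exists_adj_center hG hne
  rwa [← D.eq_u_of_adj h hw.1 hpw]

theorem u_ne_center_of_isSingular (D : Generation G F) (hG : Triconnected G)
    (hnd : F.IsNondegenerate G) (hs : F.IsSingular G) {i : ZMod F.m} (h : (D.inner i).Nonempty) :
    D.u i ≠ F.center := by
  have hP := D.isCyclicCover
  have hc : (∃! x, x ∈ D.part i ∧ G.Adj F.center x) ∧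
      ((F.IsSingular G ∧ (D.inner i).Nonempty) ∨
        (¬ F.IsSingular G ∧ D.inner (i - 1) = ∅ ∧ D.inner (i + 1) = ∅)) := by
    refine ⟨?_, Or.inl ⟨hs, h⟩⟩
    rw [D.inner_eq] at h
    obtain ⟨w, hw, hpw⟩ := hP.exists_adj_center hG h
    exact ⟨w, ⟨hw.1, hpw⟩, fun y hy => hP.eq_of_adj_center hG hnd hs hw hpw hy.1 hy.2⟩
  have hu : D.u i = hc.1.choose := dif_pos hc
  have hspec := hc.1.choose_spec
  rw [← hu] at hspec
  intro hcen
  rw [hcen] at hspec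
  exact G.loopless.irrefl _ hspec.1.2

theorem petal_ne_u (D : Generation G F) (hG : Triconnected G) {i : ZMod F.m}
    (h : D.u i ≠ F.center) (k : ZMod F.m) : F.petal k ≠ D.u i :=
  fun h' => (D.u_mem hG h).2 (h' ▸ F.petal_mem_verts k)

/-- Consequently a member of the complex can meet the interior of a part only in its vertex
u_{i,i+1}. -/
theorem eq_u_of_mem_nbhd (D : Generation G F) (hG : Triconnected G) {i : ZMod F.m} {w : V}
    (hw : w ∈ D.part i \ F.verts) (h : w ∈ D.nbhd) : w = D.u i ∧ D.u i ≠ F.center := by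
  rcases h with h | ⟨j, rfl⟩
  · exact (hw.2 h).elim
  · have hj : D.u j ≠ F.center := fun h => hw.2 (h ▸ F.center_mem_verts)
    have := D.isCyclicCover.eq_of_mem _ hw.2 _ _ (D.u_mem hG hj).1 hw.1
    subst this
    exact ⟨rfl, hj⟩

theorem Q_mem_complex (D : Generation G F) (j : ZMod F.m) : F.Q j (j + 2) ∈ D.complex :=
  ⟨D.isCyclicCover.Q_mem_cutsets3 j, (F.Q_subset_verts _ _).trans Set.subset_union_left,
    F.petal (j + 1), Or.inl (F.petal_mem_verts _), F.petal (j + 3), Or.inl (F.petal_mem_verts _),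
    D.isCyclicCover.separates_petals j⟩

/-- If `u_i` differs from the center, then some set of the complex separates the center from
`G_{i,i+1} \ {p, u_i}`. -/
theorem exists_separator (D : Generation G F) (hG : Triconnected G) (hnd : F.IsNondegenerate G)
    {i : ZMod F.m} (h : D.u i ≠ F.center) : ∃ R ∈ D.complex, D.u i ∈ R ∧
      ∀ x ∈ D.part i, x ≠ F.center → x ≠ D.u i → SeparatesVertices G R x F.center := by
  have hP := D.isCyclicCover
  by_cases hs : F.IsSingular G
  · have hsep : ∀ x ∈ D.part i, x ≠ F.center → x ≠ D.u i →
        SeparatesVertices G (G.neighborSet F.center) x F.center := by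
      intro x hx hxc hxu
      refine (separates_of_closed (W := {F.center}) rfl hxc (fun h => G.loopless.irrefl _ h)
        (fun h' => hxu (D.eq_u_of_adj h hx h')) ?_).symm
      rintro w rfl v hv
      exact Or.inr hv
    -- In the singular case the three neighbours of `p` form the cutset. They lie in O(F), since a
    -- neighbour interior to a part is that part's u.
    refine ⟨G.neighborSet F.center, D.mem_complex hs ?_ (hsep _ (hP.left_mem i)
      (F.petal_ne_center i) (D.petal_ne_u hG h i)), D.center_adj_u h, hsep⟩
    intro y hy
    rcases hP.cases y with rfl | ⟨k, rfl⟩ | ⟨j, hj⟩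
    · exact Or.inl F.center_mem_verts
    · exact Or.inl (F.petal_mem_verts k)
    · have hj' : D.u j ≠ F.center :=
        D.u_ne_center_of_isSingular hG hnd hs ⟨y, by rwa [D.inner_eq]⟩
      exact Or.inr ⟨j, (D.eq_u_of_adj hj' hj.1 hy).symm⟩
  · have n₁ := F.one_ne
    have n₂ := F.two_ne
    have n₃ := F.three_ne
    obtain ⟨hl, hr⟩ : D.inner (i - 1) = ∅ ∧ D.inner (i + 1) = ∅ := by
      rcases (D.u_cases h).2.2 with h' | h'
      exacts [(hs h'.1).elim, h'.2]
    rw [D.inner_eq] at hl hr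
    have hnotl : F.petal (i - 1) ∉ D.part i := by
      rw [hP.petal_mem_iff]
      rintro (e | e)
      · exact n₁ (by linear_combination -e)
      · exact n₂ (by linear_combination -e)
    have hnotr : F.petal (i + 2) ∉ D.part i := by
      rw [hP.petal_mem_iff]
      rintro (e | e)
      · exact n₂ (by linear_combination e)
      · exact n₁ (by linear_combination e)
    -- In the nonsingular case both adjacent parts are empty. The part without `p` and u_{i,i+1} can
    -- then be left only through q_{i-1}, q_{i+2} or u_{i,i+1}.
    have hsep : ∀ x ∈ D.part i, x ≠ F.center → x ≠ D.u i →
        SeparatesVertices G {F.petal (i - 1), D.u i, F.petal (i + 2)} x F.center := by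
      intro x hx hxc hxu
      refine separates_of_closed (W := D.part i \ {F.center, D.u i}) ⟨hx, ?_⟩
        (fun h => h.2 (Or.inl rfl)) ?_ ?_ ?_
      · rintro (h | h)
        exacts [hxc h, hxu h]
      · rintro (rfl | h | rfl)
        exacts [hnotl hx, hxu h, hnotr hx]
      · rintro (h' | h' | h')
        exacts [F.petal_ne_center _ h'.symm, h h'.symm, F.petal_ne_center _ h'.symm]
      · rintro w ⟨hw, hw'⟩ v hwv
        have hvc : v ≠ F.center := by
          rintro rfl
          exact hw' (Or.inr (D.eq_u_of_adj h hw hwv.symm))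
        have key : v ∈ D.part i → v ∈ D.part i \ {F.center, D.u i} ∨
            v ∈ ({F.petal (i - 1), D.u i, F.petal (i + 2)} : Set V) := by
          intro hv
          by_cases hvu : v = D.u i
          · exact Or.inr (Or.inr (Or.inl hvu))
          · refine Or.inl ⟨hv, ?_⟩
            rintro (h | h)
            exacts [hvc h, hvu h]
        rcases hP.mem_cases hw with hw | rfl | rfl | rfl
        · exact key (hP.mem_of_adj hw hwv)
        · rcases hP.mem_of_petal_adj hwv with hv | hv
          · rcases hP.mem_of_eq_empty hl hv with rfl | rfl | rfl
            · exact Or.inr (Or.inl rfl)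
            · rw [sub_add_cancel] at key ⊢
              exact key (hP.left_mem i)
            · exact (hvc rfl).elim
          · exact key hv
        · rcases hP.mem_of_petal_adj hwv with hv | hv
          · rw [add_sub_cancel_right] at hv
            exact key hv
          · rcases hP.mem_of_eq_empty hr hv with rfl | rfl | rfl
            · exact key (hP.right_mem i)
            · exact Or.inr (Or.inr (Or.inr (by rw [add_assoc, one_add_one_eq_two]; rfl)))
            · exact (hvc rfl).elim
        · exact (hw' (Or.inl rfl)).elim
    refine ⟨_, D.mem_complex ?_ ?_ (hsep _ (hP.left_mem i)
      (F.petal_ne_center i) (D.petal_ne_u hG h i)), Or.inr (Or.inl rfl), hsep⟩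
    · exact ncard_triple (D.petal_ne_u hG h _)
        (F.petal_ne fun e => n₃ (by linear_combination -e)) (D.petal_ne_u hG h _).symm
    · rintro v (rfl | rfl | rfl)
      · exact Or.inl (F.petal_mem_verts _)
      · exact Or.inr ⟨i, rfl⟩
      · exact Or.inl (F.petal_mem_verts _)

theorem notMem_of_not_splits (D : Generation G F) (hG : Triconnected G)
    (hnd : F.IsNondegenerate G) {A : Set V} (hA : ∀ R ∈ D.complex, ¬ Splits G R A)
    (hc : F.center ∈ A) {i : ZMod F.m} (h : D.u i ≠ F.center) {x : V} (hx : x ∈ D.part i)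
    (hxc : x ≠ F.center) (hxu : x ≠ D.u i) : x ∉ A := by
  obtain ⟨R, hR, -, hsep⟩ := D.exists_separator hG hnd h
  exact fun hxA => hA R hR ⟨x, hxA, _, hc, hsep x hx hxc hxu⟩

end Generation

end CyclicTuple

/-! ### Determination of the parts of the complex. -/

namespace CyclicTuple

variable {F : CyclicTuple V}

namespace Generation

theorem notMem_of_mem_complex [Finite V] (D : Generation G F) (hG : Triconnected G) {R : Set V}
    (hR : R ∈ D.complex) {i : ZMod F.m} (hu : D.u i ∉ R ∨ D.u i = F.center) :
    ∀ w ∈ D.part i \ F.verts, w ∉ R := by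
  intro w hw hwR
  obtain ⟨rfl, h⟩ := D.eq_u_of_mem_nbhd hG hw (hR.2.1 hwR)
  exact hu.elim (fun h' => h' hwR) h

theorem eq_of_mem_of_ncard [Finite V] {R : Set V} {a b c : V} (hR : R.ncard = 3)
    (hab : a ≠ b) (hac : a ≠ c) (hbc : b ≠ c) (ha : a ∈ R) (hb : b ∈ R) (hc : c ∈ R) :
    R = {a, b, c} := by
  refine (Set.eq_of_subset_of_ncard_le ?_ ?_ (Set.toFinite R)).symm
  · rintro v (rfl | rfl | rfl) <;> assumption
  · rw [hR, ncard_triple hab hac hbc]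

theorem part'_eq_diff (D : Generation G F) {i : ZMod F.m} (h : D.u i ≠ F.center ∨
    (D.inner i = ∅ ∧ (D.u (i - 1) ≠ F.center ∨ D.u (i + 1) ≠ F.center))) :
    D.part' i = D.part i \ {F.center} :=
  if_pos h

theorem part'_eq_part (D : Generation G F) {i : ZMod F.m} (h : D.u i = F.center)
    (h' : (D.inner i).Nonempty ∨ (D.u (i - 1) = F.center ∧ D.u (i + 1) = F.center)) :
    D.part' i = D.part i := by
  refine if_neg ?_
  rintro (hu | ⟨he, hu⟩)
  · exact hu h
  · rcases h' with h' | h'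
    · exact h'.ne_empty he
    · exact hu.elim (fun hu => hu h'.1) (fun hu => hu h'.2)

theorem part'_subset (D : Generation G F) (i : ZMod F.m) : D.part' i ⊆ D.part i := by
  unfold part'
  split_ifs
  · exact Set.sdiff_subset
  · exact subset_rfl

theorem diff_subset_part' (D : Generation G F) (i : ZMod F.m) :
    D.part i \ {F.center} ⊆ D.part' i := by
  unfold part'
  split_ifs
  · exact subset_rfl
  · exact Set.sdiff_subset

variable [Finite V]

/-- Otherwise `R` is Q'_{i,i+1}. Outside the part everything stays joined, `p` has a neighbour
there, and O(F) has no other vertex inside the part, so `R` would not split O(F). -/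
theorem notMem_or_notMem_of_u_mem (D : Generation G F) (hG : Triconnected G) {R : Set V}
    (hR : R ∈ D.complex) {i : ZMod F.m} (h : D.u i ≠ F.center) (hu : D.u i ∈ R) :
    F.petal i ∉ R ∨ F.petal (i + 1) ∉ R := by
  have hP := D.isCyclicCover
  by_contra! hlr
  have hReq := eq_of_mem_of_ncard hR.1.1 (D.petal_ne_u hG h i) (IsCyclicCover.left_ne_right F i)
    (D.petal_ne_u hG h (i + 1)).symm hlr.1 hu hlr.2
  have hRi : R ⊆ D.part i := by
    rw [hReq]
    rintro v (rfl | rfl | rfl)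
    exacts [hP.left_mem i, (D.u_mem hG h).1, hP.right_mem i]
  refine not_splits_of_joined (F.petal (i + 2)) ?_ hR.2.2
  intro x hx hxR
  by_cases hxi : x ∈ D.part i
  · rcases hP.mem_cases hxi with hxi | rfl | rfl | rfl
    · exact (hxR ((D.eq_u_of_mem_nbhd hG hxi hx).1 ▸ hu)).elim
    · exact (hxR hlr.1).elim
    · exact (hxR hlr.2).elim
    · obtain ⟨y, hy, hpy⟩ := hP.exists_adj_center_notMem hG i
      exact (Joined.of_adj hpy hxR fun h => hy (hRi h)).trans (hP.joined_of_notMem hG hRi hy)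
  · exact hP.joined_of_notMem hG hRi hxi

theorem notMem_or_notMem_of_center_mem (D : Generation G F) (hG : Triconnected G) {R : Set V}
    (hR : R ∈ D.complex) {i : ZMod F.m} (h : D.u i = F.center) (hc : F.center ∈ R) :
    F.petal i ∉ R ∨ F.petal (i + 1) ∉ R := by
  have hP := D.isCyclicCover
  by_contra! hlr
  have hReq := eq_of_mem_of_ncard hR.1.1 (IsCyclicCover.left_ne_right F i) (F.petal_ne_center i)
    (F.petal_ne_center (i + 1)) hlr.1 hlr.2 hc
  have hRi : R ⊆ D.part i := by
    rw [hReq]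
    rintro v (rfl | rfl | rfl)
    exacts [hP.left_mem i, hP.right_mem i, hP.center_mem i]
  refine not_splits_of_joined (F.petal (i + 2)) ?_ hR.2.2
  intro x hx hxR
  by_cases hxi : x ∈ D.part i
  · rcases hP.mem_cases hxi with hxi | rfl | rfl | rfl
    · exact ((D.eq_u_of_mem_nbhd hG hxi hx).2 h).elim
    · exact (hxR hlr.1).elim
    · exact (hxR hlr.2).elim
    · exact (hxR hc).elim
  · exact hP.joined_of_notMem hG hRi hxi

/-- The critical case is u_{i,i+1} ∈ R. One petal survives, the rest of the interior attaches to it,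
and maximality joins the two petals when both survive. -/
theorem not_splits_part_diff (D : Generation G F) (hG : Triconnected G)
    (hF : F.IsMaximalFlower G) {R : Set V} (hR : R ∈ D.complex) {i : ZMod F.m}
    (h : D.u i ≠ F.center) : ¬ Splits G R (D.part i \ {F.center}) := by
  have hP := D.isCyclicCover
  by_cases hu : D.u i ∈ R
  · have hlr := D.notMem_or_notMem_of_u_mem hG hR h hu
    have hRx : ∀ w ∈ D.part i \ F.verts, w ∈ R → w = D.u i :=
      fun w hw hwR => (D.eq_u_of_mem_nbhd hG hw (hR.2.1 hwR)).1
    have hJ := hP.joined_of_isMaximalFlower hG hF (D.u_mem hG h) hRx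
    -- Since u_{i,i+1} is the only neighbour of `p` in the part, it replaces `p` in the boundary of
    -- the remaining interior.
    have hI : ∀ w ∈ (D.part i \ F.verts) \ {D.u i}, ∀ v, G.Adj w v →
        v ∈ (D.part i \ F.verts) \ {D.u i} ∨ v = F.petal i ∨ v = D.u i ∨ v = F.petal (i + 1) := by
      intro w hw v hwv
      rcases hP.inner_adj w hw.1 v hwv with hv | rfl | rfl | rfl
      · by_cases hvu : v = D.u i
        · exact Or.inr (Or.inr (Or.inl hvu))
        · exact Or.inl ⟨hv, hvu⟩
      · exact Or.inr (Or.inl rfl)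
      · exact Or.inr (Or.inr (Or.inr rfl))
      · exact (hw.2 (D.eq_u_of_adj h hw.1.1 hwv.symm)).elim
    have hIR : ∀ w ∈ (D.part i \ F.verts) \ {D.u i}, w ∉ R :=
      fun w hw hwR => hw.2 (hRx w hw.1 hwR)
    have hpI : ∀ k, F.petal k ∉ (D.part i \ F.verts) \ {D.u i} :=
      fun k hk => hk.1.2 (F.petal_mem_verts k)
    have huI : D.u i ∉ (D.part i \ F.verts) \ {D.u i} := fun hk => hk.2 rfl
    rcases hlr with hl | hr
    · refine not_splits_of_joined (F.petal i) ?_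
      rintro x ⟨hx, hxc⟩ hxR
      rcases hP.mem_cases hx with hx | rfl | rfl | rfl
      · exact hG.joined_of_mem (D.petal_ne_u hG h i) (IsCyclicCover.left_ne_right F i)
          (D.petal_ne_u hG h (i + 1)).symm (hpI _) huI (hpI _) hI hIR
          ⟨hx, fun hxu => hxR (hxu ▸ hu)⟩ hl
      · exact .refl hl
      · exact (hJ hl hxR).symm
      · exact (hxc rfl).elim
    · refine not_splits_of_joined (F.petal (i + 1)) ?_
      rintro x ⟨hx, hxc⟩ hxR
      rcases hP.mem_cases hx with hx | rfl | rfl | rfl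
      · exact hG.joined_of_mem (D.petal_ne_u hG h (i + 1))
          (IsCyclicCover.left_ne_right F i).symm (D.petal_ne_u hG h i).symm (hpI _) huI (hpI _)
          (fun w hw v hwv => by have := hI w hw v hwv; tauto) hIR
          ⟨hx, fun hxu => hxR (hxu ▸ hu)⟩ hr
      · exact hJ hxR hr
      · exact .refl hr
      · exact (hxc rfl).elim
  · have hint := D.notMem_of_mem_complex hG hR (Or.inl hu)
    by_cases hlr : F.petal i ∉ R ∨ F.petal (i + 1) ∉ R
    · exact hP.not_splits_diff_center hG hint hlr
    · push Not at hlr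
      -- Both petals lie in `R`, but every component of the interior contains a neighbour of `p`,
      -- which can only be u_{i,i+1}.
      refine not_splits_of_joined (D.u i) ?_
      rintro x ⟨hx, hxc⟩ hxR
      rcases hP.mem_cases hx with hx | rfl | rfl | rfl
      · obtain ⟨w, hw, hxw, hwp⟩ := hP.exists_joined_adj_center hG hint hx
        rwa [D.eq_u_of_adj h hw.1 hwp.symm] at hxw
      · exact (hxR hlr.1).elim
      · exact (hxR hlr.2).elim
      · exact (hxc rfl).elim

theorem not_splits_part_of_center_mem (D : Generation G F) (hG : Triconnected G) {R : Set V}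
    (hR : R ∈ D.complex) {i : ZMod F.m} (h : D.u i = F.center) (hc : F.center ∈ R) :
    ¬ Splits G R (D.part i) :=
  D.isCyclicCover.not_splits_of_center_mem hG hc (D.notMem_of_mem_complex hG hR (Or.inr h))
    (D.notMem_or_notMem_of_center_mem hG hR h hc)

theorem not_splits_part_of_nonempty (D : Generation G F) (hG : Triconnected G) {R : Set V}
    (hR : R ∈ D.complex) {i : ZMod F.m} (h : D.u i = F.center) (hne : (D.inner i).Nonempty) :
    ¬ Splits G R (D.part i) := by
  have hP := D.isCyclicCover
  by_cases hc : F.center ∈ R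
  · exact D.not_splits_part_of_center_mem hG hR h hc
  have hint := D.notMem_of_mem_complex hG hR (Or.inr h)
  rw [D.inner_eq] at hne
  obtain ⟨y, hy⟩ := hne
  have hyc := hP.joined_center hG hint hy hc
  refine not_splits_of_joined F.center ?_
  intro x hx hxR
  rcases hP.mem_cases hx with hx | rfl | rfl | rfl
  · exact hP.joined_center hG hint hx hc
  · exact (hP.joined_left hG hint hy hxR).symm.trans hyc
  · exact (hP.joined_right hG hint hy hxR).symm.trans hyc
  · exact .refl hc

/-- Each petal reaches `p` through the adjacent part on its side: by an edge if that part is empty,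
and through its interior, untouched by `R`, if not. -/
theorem not_splits_part_of_empty (D : Generation G F) (hG : Triconnected G) {R : Set V}
    (hR : R ∈ D.complex) {i : ZMod F.m} (h : D.u i = F.center) (he : D.inner i = ∅)
    (hl : D.u (i - 1) = F.center) (hr : D.u (i + 1) = F.center) : ¬ Splits G R (D.part i) := by
  have hP := D.isCyclicCover
  by_cases hc : F.center ∈ R
  · exact D.not_splits_part_of_center_mem hG hR h hc
  refine not_splits_of_joined F.center ?_
  intro x hx hxR
  have he' := he
  rw [D.inner_eq] at he'
  rcases hP.mem_of_eq_empty he' hx with rfl | rfl | rfl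
  · rcases (D.inner (i - 1)).eq_empty_or_nonempty with hne | hne
    · rw [D.inner_eq] at hne
      exact (Joined.of_adj (hP.center_adj_petal hG hne he') hc hxR).symm
    · refine not_splits_iff.1 (D.not_splits_part_of_nonempty hG hR hl hne) _ ?_ _
        (hP.center_mem _) hxR hc
      simpa using hP.right_mem (i - 1)
  · rcases (D.inner (i + 1)).eq_empty_or_nonempty with hne | hne
    · rw [D.inner_eq] at hne
      exact (Joined.of_adj
        (hP.center_adj_petal hG (by rwa [add_sub_cancel_right]) hne) hc hxR).symm
    · exact not_splits_iff.1 (D.not_splits_part_of_nonempty hG hR hr hne) _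
        (hP.left_mem (i + 1)) _ (hP.center_mem _) hxR hc
  · exact .refl hc

theorem left_mem_part' (D : Generation G F) (i : ZMod F.m) : F.petal i ∈ D.part' i :=
  D.diff_subset_part' i ⟨D.isCyclicCover.left_mem i, F.petal_ne_center i⟩

theorem right_mem_part' (D : Generation G F) (i : ZMod F.m) : F.petal (i + 1) ∈ D.part' i :=
  D.diff_subset_part' i ⟨D.isCyclicCover.right_mem i, F.petal_ne_center _⟩

theorem not_splits_part' (D : Generation G F) (hG : Triconnected G) (hF : F.IsMaximalFlower G)
    {R : Set V} (hR : R ∈ D.complex) (i : ZMod F.m) : ¬ Splits G R (D.part' i) := by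
  by_cases hu : D.u i = F.center
  · rcases (D.inner i).eq_empty_or_nonempty with he | hne
    · by_cases hlr : D.u (i - 1) = F.center ∧ D.u (i + 1) = F.center
      · rw [D.part'_eq_part hu (Or.inr hlr)]
        exact D.not_splits_part_of_empty hG hR hu he hlr.1 hlr.2
      · rw [D.part'_eq_diff (Or.inr ⟨he, not_and_or.1 hlr⟩)]
        rw [D.inner_eq] at he
        intro hs
        refine not_splits_pair (D.isCyclicCover.petal_adj_petal hG he) (hs.mono ?_)
        rintro x ⟨hx, hxc⟩
        rcases D.isCyclicCover.mem_of_eq_empty he hx with h | h | h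
        exacts [Or.inl h, Or.inr h, (hxc h).elim]
    · rw [D.part'_eq_part hu (Or.inl hne)]
      exact D.not_splits_part_of_nonempty hG hR hu hne
  · rw [D.part'_eq_diff (Or.inl hu)]
    exact D.not_splits_part_diff hG hF hR hu

theorem center_adj_of_mem_centerNbhd (D : Generation G F) (hG : Triconnected G) {x : V}
    (hx : x ∈ D.centerNbhd) : G.Adj F.center x := by
  rcases hx with ⟨i, rfl, hi⟩ | ⟨j, rfl, hl, hr, -, -⟩
  · exact D.center_adj_u hi
  · rw [D.inner_eq] at hl hr
    exact D.isCyclicCover.center_adj_petal hG hl hr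

/-- The definition of T(p) makes every G_{i,i+1} containing `x` one of those that lose `p`. -/
theorem not_pair_subset_part' (D : Generation G F) (hG : Triconnected G) {x : V}
    (hx : x ∈ D.centerNbhd) (i : ZMod F.m) : ¬ ({F.center, x} : Set V) ⊆ D.part' i := by
  have hP := D.isCyclicCover
  intro hsub
  have hc : F.center ∈ D.part' i := hsub (Or.inl rfl)
  have hxi : x ∈ D.part i := D.part'_subset i (hsub (Or.inr rfl))
  suffices h : D.part' i = D.part i \ {F.center} by
    rw [h] at hc
    exact hc.2 rfl
  apply D.part'_eq_diff
  rcases hx with ⟨k, rfl, hk⟩ | ⟨j, rfl, hl, hr, hl', hr'⟩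
  · have hu := D.u_mem hG hk
    rw [← hP.eq_of_mem _ hu.2 _ _ hu.1 hxi]
    exact Or.inl hk
  · rcases hP.petal_mem_iff.1 hxi with rfl | rfl
    · exact Or.inr ⟨hr, Or.inr hr'⟩
    · rw [add_sub_cancel_right] at hl
      rw [show i + 1 - 2 = i - 1 by ring] at hl'
      exact Or.inr ⟨hl, Or.inl hl'⟩

theorem exists_superset_of_not_splits (D : Generation G F) (hG : Triconnected G)
    (hnd : F.IsNondegenerate G) {A : Set V} (hA : ∀ R ∈ D.complex, ¬ Splits G R A) :
    ∃ B ∈ Set.range D.part' ∪ {A | ∃ x ∈ D.centerNbhd, A = {F.center, x}}, A ⊆ B := by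
  have hP := D.isCyclicCover
  obtain ⟨i, hi⟩ := hP.exists_subset fun j => hA _ (D.Q_mem_complex j)
  have hpart : ∀ k, A ⊆ D.part' k →
      ∃ B ∈ Set.range D.part' ∪ {A | ∃ x ∈ D.centerNbhd, A = {F.center, x}}, A ⊆ B :=
    fun k hk => ⟨_, Or.inl ⟨k, rfl⟩, hk⟩
  have hpair : ∀ x ∈ D.centerNbhd, A ⊆ {F.center, x} →
      ∃ B ∈ Set.range D.part' ∪ {A | ∃ x ∈ D.centerNbhd, A = {F.center, x}}, A ⊆ B :=
    fun x hx h => ⟨_, Or.inr ⟨x, hx, rfl⟩, h⟩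
  by_cases hc : F.center ∈ A
  swap
  · exact hpart i fun x hx => D.diff_subset_part' i ⟨hi hx, by rintro rfl; exact hc hx⟩
  have hnot {k : ZMod F.m} (h : D.u k ≠ F.center) {x : V} (hx : x ∈ D.part k) :=
    D.notMem_of_not_splits hG hnd hA hc h hx
  by_cases hu : D.u i = F.center
  swap
  · refine hpair (D.u i) (Or.inl ⟨i, rfl, hu⟩) fun x hx => ?_
    by_contra hx'
    have hx'' := not_or.1 hx'
    exact hnot hu (hi hx) hx''.1 hx''.2 hx
  rcases (D.inner i).eq_empty_or_nonempty with he | hne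
  swap
  · exact hpart i (by rwa [D.part'_eq_part hu (Or.inl hne)])
  have he' := he
  rw [D.inner_eq] at he'
  -- With `p` in `A`, a petal of the empty part is excluded as soon as the adjacent part on its side
  -- has u ≠ p.
  have hleft : D.u (i - 1) ≠ F.center → F.petal i ∉ A := fun h =>
    hnot h (by simpa using hP.right_mem (i - 1)) (F.petal_ne_center i) (D.petal_ne_u hG h i)
  have hright : D.u (i + 1) ≠ F.center → F.petal (i + 1) ∉ A := fun h =>
    hnot h (hP.left_mem (i + 1)) (F.petal_ne_center _) (D.petal_ne_u hG h _)
  by_cases hl : D.u (i - 1) = F.center <;> by_cases hr : D.u (i + 1) = F.center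
  · exact hpart i (by rwa [D.part'_eq_part hu (Or.inr ⟨hl, hr⟩)])
  · have hAsub : A ⊆ {F.center, F.petal i} := by
      intro x hx
      rcases hP.mem_of_eq_empty he' (hi hx) with h | h | h
      exacts [Or.inr h, (hright hr (h ▸ hx)).elim, Or.inl h]
    -- The pair {p, q_i} fits into G'_{i-1,i} unless that set has lost `p`; as u_{i-1,i} = u_{i,i+1}
    -- = p, this happens exactly when q_i belongs to T(p).
    by_cases h : (D.inner (i - 1)).Nonempty ∨ D.u (i - 2) = F.center
    · refine hpart (i - 1) (hAsub.trans ?_)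
      rw [D.part'_eq_part hl (h.imp_right fun h =>
        ⟨by rwa [sub_sub, one_add_one_eq_two], by rwa [sub_add_cancel]⟩)]
      rintro x (rfl | rfl)
      exacts [hP.center_mem _, by simpa using hP.right_mem (i - 1)]
    · push Not at h
      exact hpair _ (Or.inr ⟨i, rfl, h.1, he, h.2, hr⟩) hAsub
  · have hAsub : A ⊆ {F.center, F.petal (i + 1)} := by
      intro x hx
      rcases hP.mem_of_eq_empty he' (hi hx) with h | h | h
      exacts [(hleft hl (h ▸ hx)).elim, Or.inr h, Or.inl h]
    by_cases h : (D.inner (i + 1)).Nonempty ∨ D.u (i + 1 + 1) = F.center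
    · refine hpart (i + 1) (hAsub.trans ?_)
      rw [D.part'_eq_part hr (h.imp_right fun h => ⟨by rwa [add_sub_cancel_right], h⟩)]
      rintro x (rfl | rfl)
      exacts [hP.center_mem _, hP.left_mem (i + 1)]
    · push Not at h
      exact hpair _ (Or.inr ⟨i + 1, rfl, by rwa [add_sub_cancel_right], h.1,
        by rwa [show i + 1 - 2 = i - 1 by ring], h.2⟩) hAsub
  -- Both petals are excluded, so `A` is just {p} and any pair from T(p) contains it.
  · refine hpair _ (Or.inl ⟨i - 1, rfl, hl⟩) fun x hx => ?_
    rcases hP.mem_of_eq_empty he' (hi hx) with h | h | h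
    exacts [(hleft hl (h ▸ hx)).elim, (hright hr (h ▸ hx)).elim, Or.inl h]

theorem parts_complex (D : Generation G F) (hG : Triconnected G) (hF : F.IsMaximalFlower G)
    (hnd : F.IsNondegenerate G) : parts G D.complex =
      Set.range D.part' ∪ {A | ∃ x ∈ D.centerNbhd, A = {F.center, x}} := by
  have hP := D.isCyclicCover
  refine parts_eq_of_antichain ?_ ?_ fun A hA => D.exists_superset_of_not_splits hG hnd hA
  · rintro _ (⟨i, rfl⟩ | ⟨x, hx, rfl⟩) R hR
    · exact D.not_splits_part' hG hF hR i
    · exact not_splits_pair (D.center_adj_of_mem_centerNbhd hG hx)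
  · rintro _ (⟨i, rfl⟩ | ⟨x, hx, rfl⟩) _ (⟨j, rfl⟩ | ⟨y, hy, rfl⟩) h
    · rw [hP.eq_of_subset (D.part'_subset j (h (D.left_mem_part' i)))
        (D.part'_subset j (h (D.right_mem_part' i)))]
    · have h₁ := (h (D.left_mem_part' i)).resolve_left (F.petal_ne_center _)
      have h₂ := (h (D.right_mem_part' i)).resolve_left (F.petal_ne_center _)
      exact (IsCyclicCover.left_ne_right F i (h₁.trans h₂.symm)).elim
    · exact (D.not_pair_subset_part' hG hx j h).elim
    · have hxc := (D.center_adj_of_mem_centerNbhd hG hx).ne'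
      rw [(h (Or.inr rfl)).resolve_left hxc]

theorem isSmall_part'_iff (D : Generation G F) (hG : Triconnected G) (i : ZMod F.m) :
    IsSmall (D.part' i) ↔
      D.inner i = ∅ ∧ (D.u (i - 1) ≠ F.center ∨ D.u (i + 1) ≠ F.center) := by
  have hP := D.isCyclicCover
  constructor
  · intro hs
    by_contra h
    have h3 : ∃ T ⊆ D.part' i, T.ncard = 3 := by
      by_cases hu : D.u i = F.center
      · refine ⟨F.Q i (i + 1), ?_, F.ncard_Q (by simpa using F.one_ne)⟩
        rw [D.part'_eq_part hu, ← hP.inter_verts]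
        · exact Set.inter_subset_left
        · by_contra! h'
          exact h ⟨h'.1, not_and_or.1 fun hlr => h'.2 hlr.1 hlr.2⟩
      · refine ⟨_, ?_, ncard_triple (D.petal_ne_u hG hu i) (IsCyclicCover.left_ne_right F i)
          (D.petal_ne_u hG hu (i + 1)).symm⟩
        rintro x (rfl | rfl | rfl)
        exacts [D.left_mem_part' i, D.diff_subset_part' i ⟨(D.u_mem hG hu).1, hu⟩,
          D.right_mem_part' i]
    obtain ⟨T, hT, hT3⟩ := h3
    have := Set.ncard_le_ncard hT (Set.toFinite _)
    have hs' : (D.part' i).ncard < 3 := hs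
    omega
  · intro h
    have hsub : D.part' i ⊆ {F.petal i, F.petal (i + 1)} := by
      rw [D.part'_eq_diff (Or.inr h)]
      rintro x ⟨hx, hxc⟩
      rw [D.inner_eq] at h
      rcases hP.mem_of_eq_empty h.1 hx with h | h | h
      exacts [Or.inl h, Or.inr h, (hxc h).elim]
    have := Set.ncard_le_ncard hsub (Set.toFinite _)
    have := ncard_pair_le (F.petal i) (F.petal (i + 1))
    change (D.part' i).ncard < 3
    omega

theorem boundary_part' (D : Generation G F) (hG : Triconnected G) (hnd : F.IsNondegenerate G)
    {i : ZMod F.m} (h : IsNormal (D.part' i)) : boundary D.complex (D.part' i) = D.Q' i := by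
  have hP := D.isCyclicCover
  have hpetal : ∀ k, ∃ S ∈ D.complex, F.petal k ∈ S :=
    fun k => ⟨_, D.Q_mem_complex k, Or.inl rfl⟩
  have hns : ¬ IsSmall (D.part' i) := not_lt.2 h
  rw [D.isSmall_part'_iff hG] at hns
  ext v
  constructor
  · rintro ⟨hv, S, hS, hvS⟩
    rcases hP.mem_cases (D.part'_subset i hv) with hv' | rfl | rfl | rfl
    · exact Or.inr (Or.inl (D.eq_u_of_mem_nbhd hG hv' (hS.2.1 hvS)).1)
    · exact Or.inl rfl
    · exact Or.inr (Or.inr rfl)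
    · by_cases hu : D.u i = F.center
      · exact Or.inr (Or.inl hu.symm)
      · rw [D.part'_eq_diff (Or.inl hu)] at hv
        exact (hv.2 rfl).elim
  · rintro (rfl | rfl | rfl)
    · exact ⟨D.left_mem_part' i, hpetal _⟩
    · by_cases hu : D.u i = F.center
      · rw [hu]
        refine ⟨?_, _, D.Q_mem_complex i, Or.inr (Or.inr rfl)⟩
        rw [D.part'_eq_part hu]
        · exact hP.center_mem i
        · by_contra! h'
          exact hns ⟨h'.1, not_and_or.1 fun hlr => h'.2 hlr.1 hlr.2⟩
      -- The Q_{j,j+2} account for the petals and `p`; for u_{i,i+1} ≠ p the separator supplies the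
      -- needed member of the complex.
      · obtain ⟨R, hR, huR, -⟩ := D.exists_separator hG hnd hu
        exact ⟨D.diff_subset_part' i ⟨(D.u_mem hG hu).1, hu⟩, R, hR, huR⟩
    · exact ⟨D.right_mem_part' i, hpetal _⟩

end Generation

end CyclicTuple

end FlowerComplex

theorem mainTheorem4 {V : Type*} [Finite V] (G : SimpleGraph V)
    (hG : FlowerComplex.Triconnected G) (hV : 6 < Nat.card V)
    (F : FlowerComplex.CyclicTuple V) (hmax : F.IsMaximalFlower G)
    (hnd : F.IsNondegenerate G) (D : F.Generation G) :
    FlowerComplex.parts G D.complex =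
        Set.range D.part' ∪ {A | ∃ x ∈ D.centerNbhd, A = {F.center, x}} ∧
      (∀ x ∈ D.centerNbhd, FlowerComplex.IsSmall ({F.center, x} : Set V)) ∧
      (∀ i : ZMod F.m, FlowerComplex.IsSmall (D.part' i) ↔
        D.inner i = ∅ ∧ (D.u (i - 1) ≠ F.center ∨ D.u (i + 1) ≠ F.center)) ∧
      (∀ i : ZMod F.m, FlowerComplex.IsNormal (D.part' i) →
        FlowerComplex.boundary D.complex (D.part' i) = D.Q' i) :=
  ⟨D.parts_complex hG hmax hnd, fun x _ => (FlowerComplex.ncard_pair_le F.center x).trans_lt (by norm_num),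
    D.isSmall_part'_iff hG, fun _ => D.boundary_part' hG hnd⟩
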